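/- **Conventions.** Distances between nonempty sets are infima: $d(A,B)=\inf\{d(a,b):a\in A,b\in B\}$. For $A,B\in\mathbb R$, put $\{\!\{A\}\!\}_s=A$ if $A\ge s$ and $\{\!\{A\}\!\}_s=0$ otherwise, and write $A\asymp_{K,C}B$ if $K^{-1}A-C\le B\le KA+C$. A subset $Y$ of a geodesic metric space is $k$-quasiconvex if every geodesic segment with endpoints in $Y$ lies in the closed $k$-neighbourhood $\mathcal N_k(Y)$. A $q$-quasigeodesic space is a metric space any two points of which are joined by a $(q,q)$-quasi-isometric embedding of a compact interval. A $\delta$-hyperbolic space is a geodesic metric space in which each side of every geodesic triangle lies in the closed $\delta$-neighbourhood of the union of the other two. **Definition.** A *hierarchically hyperbolic space* $(\mathcal X,\mathfrak S)$ is a $q$-quasigeodesic metric space $(\mathcal X,d_{\mathcal X})$ together with an index set $\mathfrak S$, a number $\delta\ge 0$ and $\delta$-hyperbolic spaces $(\mathcal CW,d_W)$, $W\in\mathfrak S$, such that the following hold for some constants $\xi,K,\kappa_0\ge 0$, $n\in\mathbb N$, $\lambda\ge 1$, $E\ge\max\{\xi,\kappa_0\}$ and $\alpha$. All sets $\pi_W(x)$,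 $\rho^V_W$, $\rho^W_V(p)$ below are nonempty. 1. (Projections.) There are maps $\pi_W:\mathcal X\to 2^{\mathcal CW}$ with $\operatorname{diam}\pi_W(x)\le\xi$ and $d_W(\pi_W(x),\pi_W(y))\le K d_{\mathcal X}(x,y)+K$, and $\pi_W(\mathcal X)=\bigcup_{x}\pi_W(x)$ is $K$-quasiconvex in $\mathcal CW$. 2. (Nesting.) $\mathfrak S$ carries a partial order $\sqsubseteq$, with a unique $\sqsubseteq$-maximal element if $\mathfrak S\neq\emptyset$. For $V\sqsubsetneq W$ there are a set $\rho^V_W\subseteq\mathcal CW$ of diameter at most $\xi$ and a map $\rho^W_V:\mathcal CW\to 2^{\mathcal CV}$. 3. (Orthogonality.) $\mathfrak S$ carries a symmetric anti-reflexive relation $\bot$. If $V\sqsubseteq W$ and $W\bot U$, then $V\bot U$. If $U\sqsubseteq T$ and some $V\sqsubseteq T$ has $V\bot U$, then there is $W\sqsubsetneq T$ such that $V\sqsubseteq W$ whenever $V\bot U$ and $V\sqsubseteq T$. If $V\bot W$, then $V,W$ are not $\sqsubseteq$-comparable. 4. (Transversality and consistency.) $V,W$ are *transverse*, $V\pitchfork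 W$, if they are neither orthogonal nor $\sqsubseteq$-comparable. If $V\pitchfork W$, there are sets $\rho^V_W\subseteq\mathcal CW$ and $\rho^W_V\subseteq\mathcal CV$ of diameter at most $\xi$ with $\min\{d_W(\pi_W(x),\rho^V_W),d_V(\pi_V(x),\rho^W_V)\}\le\kappa_0$ for all $x\in\mathcal X$. If $V\sqsubsetneq W$, then $\min\{d_W(\pi_W(x),\rho^V_W),\operatorname{diam}_{\mathcal CV}(\pi_V(x)\cup\rho^W_V(\pi_W(x)))\}\le\kappa_0$ for all $x\in\mathcal X$. If $U\sqsubseteq V$, then $d_W(\rho^U_W,\rho^V_W)\le\kappa_0$ whenever $V\sqsubsetneq W$, or $V\pitchfork W$ and $W\not\bot U$. 5. (Finite complexity.) Every set of pairwise $\sqsubseteq$-comparable elements of $\mathfrak S$ has at most $n$ elements. 6. (Large links.) For all $W\in\mathfrak S$ and $x,x'\in\mathcal X$, with $N=\lambda d_W(\pi_W(x),\pi_W(x'))+\lambda$, there are at most $\lfloor N\rfloor$ elements $T_i\sqsubsetneq W$ with $d_W(\pi_W(x),\rho^{T_i}_W)\le N$ such that every $T\sqsubsetneq W$ satisfies $T\sqsubseteq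 T_i$ for some $i$, or $d_T(\pi_T(x),\pi_T(x'))<E$. 7. (Bounded geodesic image.) If $V\sqsubsetneq W$ and $\gamma$ is a geodesic segment in $\mathcal CW$, then $\operatorname{diam}_{\mathcal CV}(\rho^W_V(\gamma))\le E$ or $\gamma\cap\mathcal N_E(\rho^V_W)\ne\emptyset$. 8. (Partial realization.) For every family $\{V_j\}$ of pairwise orthogonal elements and all $p_j\in\pi_{V_j}(\mathcal X)$ there is $x\in\mathcal X$ such that for all $j$: $d_{V_j}(\pi_{V_j}(x),p_j)\le\alpha$, and $d_W(\pi_W(x),\rho^{V_j}_W)\le\alpha$ for every $W$ with $V_j\sqsubsetneq W$ or $W\pitchfork V_j$. 9. (Uniqueness.) For every $\kappa\ge 0$ there is $\theta_u(\kappa)$ such that $d_{\mathcal X}(x,y)\ge\theta_u(\kappa)$ implies $d_V(\pi_V(x),\pi_V(y))\ge\kappa$ for some $V\in\mathfrak S$. **Theorem (Distance Formula).** Let $(\mathcal X,\mathfrak S)$ be a hierarchically hyperbolic space, and write $d_W(x,y)=d_W(\pi_W(x),\pi_W(y))$. Then there exists $s_0$ such that for all $s\ge s_0$ there exist constants $K\ge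 1$, $C\ge 0$ such that for all $x,y\in\mathcal X$ only finitely many $W\in\mathfrak S$ satisfy $d_W(x,y)\ge s$, and $$d_{\mathcal X}(x,y)\asymp_{K,C}\sum_{W\in\mathfrak S}\{\!\{d_W(x,y)\}\!\}_s .$$ -/

import Mathlib

/-! Hierarchically hyperbolic spaces. -/

/-- `f` restricted to `[0, ℓ]` is a geodesic (an isometric embedding of the interval). -/
def IsGeodesicOn {M : Type*} [MetricSpace M] (f : ℝ → M) (ℓ : ℝ) : Prop :=
  0 ≤ ℓ ∧ ∀ s ∈ Set.Icc (0 : ℝ) ℓ, ∀ t ∈ Set.Icc (0 : ℝ) ℓ, dist (f s) (f t) = |s - t|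

/-- `γ` is (the image of) a geodesic segment from `a` to `b`. -/
def IsGeodesicSegment {M : Type*} [MetricSpace M] (γ : Set M) (a b : M) : Prop :=
  ∃ (f : ℝ → M) (ℓ : ℝ), IsGeodesicOn f ℓ ∧ f 0 = a ∧ f ℓ = b ∧ f '' Set.Icc (0 : ℝ) ℓ = γ

/-- Any two points are joined by a geodesic segment. -/
def IsGeodesicSpace (M : Type*) [MetricSpace M] : Prop :=
  ∀ a b : M, ∃ γ : Set M, IsGeodesicSegment γ a b

/-- A `δ`-hyperbolic space: a geodesic metric space in which each side of each geodesic triangle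
lies in the closed `δ`-neighbourhood of the union of the other two sides. -/
def IsHyperbolicSpace (M : Type*) [MetricSpace M] (δ : ℝ) : Prop :=
  IsGeodesicSpace M ∧
    ∀ (a b c : M) (α β γ : Set M),
      IsGeodesicSegment α a b → IsGeodesicSegment β b c → IsGeodesicSegment γ a c →
        α ⊆ Metric.cthickening δ (β ∪ γ) ∧
        β ⊆ Metric.cthickening δ (α ∪ γ) ∧
        γ ⊆ Metric.cthickening δ (α ∪ β)

/-- A `q`-quasigeodesic space: any two points are joined by a `(q, q)`-quasi-isometric embedding
of a compact interval. -/
def IsQuasigeodesicSpace (M : Type*) [MetricSpace M] (q : ℝ) : Prop :=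
  ∀ a b : M, ∃ (f : ℝ → M) (L : ℝ), 0 ≤ L ∧ f 0 = a ∧ f L = b ∧
    ∀ s ∈ Set.Icc (0 : ℝ) L, ∀ t ∈ Set.Icc (0 : ℝ) L,
      q⁻¹ * |s - t| - q ≤ dist (f s) (f t) ∧ dist (f s) (f t) ≤ q * |s - t| + q

/-- A subset `Y` is `k`-quasiconvex: geodesics with endpoints in `Y` stay `k`-close to `Y`. -/
def IsQuasiconvexSet {M : Type*} [MetricSpace M] (Y : Set M) (k : ℝ) : Prop :=
  ∀ a ∈ Y, ∀ b ∈ Y, ∀ γ : Set M, IsGeodesicSegment γ a b → γ ⊆ Metric.cthickening k Y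

/-- Distance between two (nonempty) sets: the infimum of the distances between their points. -/
noncomputable def setDist {M : Type*} [MetricSpace M] (A B : Set M) : ℝ :=
  sInf (Set.image2 dist A B)

/-- The diameter of `A` is at most `D`. -/
def DiamLE {M : Type*} [MetricSpace M] (A : Set M) (D : ℝ) : Prop :=
  ∀ a ∈ A, ∀ b ∈ A, dist a b ≤ D

/-- A hierarchically hyperbolic space `(X, 𝔖)` with associated hyperbolic spaces `C W`, `W : 𝔖`.
Nesting is the partial order `≤` on the index set `𝔖`. -/
structure HierarchicallyHyperbolicSpace (X : Type*) [MetricSpace X] (𝔖 : Type*) [PartialOrder 𝔖]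
    (C : 𝔖 → Type*) [∀ W, MetricSpace (C W)] where
  /-- the projections `π_W : X → 2^{C W}` -/
  proj : ∀ W : 𝔖, X → Set (C W)
  /-- orthogonality -/
  orth : 𝔖 → 𝔖 → Prop
  /-- the subset `ρ^V_W` of `C W`, meaningful when `V` is properly nested in `W` or when `V` and
  `W` are transverse -/
  rho : 𝔖 → ∀ W : 𝔖, Set (C W)
  /-- the projection `ρ^W_V : C W → 2^{C V}`, meaningful when `V` is properly nested in `W` -/
  rhoDown : ∀ W V : 𝔖, C W → Set (C V)
  -- constants
  q : ℝ
  δ : ℝ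
  ξ : ℝ
  K : ℝ
  κ₀ : ℝ
  n : ℕ
  lam : ℝ
  E : ℝ
  α : ℝ
  one_le_q : 1 ≤ q
  δ_nonneg : 0 ≤ δ
  ξ_nonneg : 0 ≤ ξ
  K_nonneg : 0 ≤ K
  κ₀_nonneg : 0 ≤ κ₀
  one_le_lam : 1 ≤ lam
  max_le_E : max ξ κ₀ ≤ E
  -- the underlying spaces
  quasigeodesic : IsQuasigeodesicSpace X q
  hyperbolic : ∀ W, IsHyperbolicSpace (C W) δ
  -- projections
  proj_nonempty : ∀ W x, (proj W x).Nonempty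
  proj_diam : ∀ W x, DiamLE (proj W x) ξ
  proj_lipschitz : ∀ W x y, setDist (proj W x) (proj W y) ≤ K * dist x y + K
  proj_quasiconvex : ∀ W, IsQuasiconvexSet (⋃ x, proj W x) K
  -- nesting
  unique_maximal : Nonempty 𝔖 → ∃! S : 𝔖, IsMax S
  rho_nested_nonempty : ∀ V W, V < W → (rho V W).Nonempty
  rho_nested_diam : ∀ V W, V < W → DiamLE (rho V W) ξ
  rhoDown_nonempty : ∀ V W, V < W → ∀ p, (rhoDown W V p).Nonempty
  -- orthogonality
  orth_symm : ∀ V W, orth V W → orth W V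
  orth_irrefl : ∀ V, ¬ orth V V
  orth_of_nested : ∀ V W U, V ≤ W → orth W U → orth V U
  orth_container : ∀ T U, U ≤ T → (∃ V, V ≤ T ∧ orth V U) →
    ∃ W, W < T ∧ ∀ V, orth V U → V ≤ T → V ≤ W
  orth_not_comparable : ∀ V W, orth V W → ¬ V ≤ W ∧ ¬ W ≤ V
  -- transversality and consistency
  rho_transverse_nonempty : ∀ V W, ¬ orth V W → ¬ V ≤ W → ¬ W ≤ V → (rho V W).Nonempty
  rho_transverse_diam : ∀ V W, ¬ orth V W → ¬ V ≤ W → ¬ W ≤ V → DiamLE (rho V W) ξ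
  consistency_transverse : ∀ V W, ¬ orth V W → ¬ V ≤ W → ¬ W ≤ V → ∀ x,
    min (setDist (proj W x) (rho V W)) (setDist (proj V x) (rho W V)) ≤ κ₀
  consistency_nested : ∀ V W, V < W → ∀ x,
    setDist (proj W x) (rho V W) ≤ κ₀ ∨
      DiamLE (proj V x ∪ ⋃ p ∈ proj W x, rhoDown W V p) κ₀
  rho_close : ∀ U V W, U ≤ V →
    (V < W ∨ ((¬ orth V W ∧ ¬ V ≤ W ∧ ¬ W ≤ V) ∧ ¬ orth W U)) →
      setDist (rho U W) (rho V W) ≤ κ₀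
  -- finite complexity
  finite_complexity : ∀ c : Set 𝔖, IsChain (· ≤ ·) c → c.encard ≤ n
  -- large links
  large_links : ∀ (W : 𝔖) (x x' : X), ∃ 𝒯 : Finset 𝔖,
    𝒯.card ≤ ⌊lam * setDist (proj W x) (proj W x') + lam⌋₊ ∧
    (∀ T ∈ 𝒯, T < W ∧
      setDist (proj W x) (rho T W) ≤ lam * setDist (proj W x) (proj W x') + lam) ∧
    ∀ T, T < W → (∃ T' ∈ 𝒯, T ≤ T') ∨ setDist (proj T x) (proj T x') < E
  -- bounded geodesic image
  bounded_geodesic_image : ∀ V W, V < W → ∀ (a b : C W) (γ : Set (C W)),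
    IsGeodesicSegment γ a b →
      DiamLE (⋃ p ∈ γ, rhoDown W V p) E ∨ (γ ∩ Metric.cthickening E (rho V W)).Nonempty
  -- partial realization, for a family of pairwise orthogonal elements
  partial_realization : ∀ 𝒱 : Set 𝔖, 𝒱.Pairwise orth →
    ∀ p : (∀ V : 𝒱, C V), (∀ V : 𝒱, p V ∈ ⋃ x, proj V x) →
      ∃ x : X, ∀ V : 𝒱,
        setDist (proj V x) {p V} ≤ α ∧
        (∀ W, (V : 𝔖) < W → setDist (proj W x) (rho V W) ≤ α) ∧
        (∀ W, ¬ orth W V → ¬ W ≤ V → ¬ (V : 𝔖) ≤ W → setDist (proj W x) (rho V W) ≤ α)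
  -- uniqueness
  uniqueness : ∀ κ : ℝ, 0 ≤ κ → ∃ θ : ℝ, ∀ x y : X, θ ≤ dist x y →
    ∃ V, κ ≤ setDist (proj V x) (proj V y)

/-- `d_W(x, y)`, the distance in `C W` between the projections of `x` and `y`. -/
noncomputable def HierarchicallyHyperbolicSpace.projDist {X : Type*} [MetricSpace X] {𝔖 : Type*}
    [PartialOrder 𝔖] {C : 𝔖 → Type*} [∀ W, MetricSpace (C W)]
    (H : HierarchicallyHyperbolicSpace X 𝔖 C) (W : 𝔖) (x y : X) : ℝ :=
  setDist (H.proj W x) (H.proj W y)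

open Classical in
/-- The quantity which is `A` if `A ≥ s` and `0` otherwise. -/
noncomputable def ignoreBelow (A s : ℝ) : ℝ := if s ≤ A then A else 0

/-- `A ≍_{K, D} B`. -/
def CoarselyEqual (K D A B : ℝ) : Prop := K⁻¹ * A - D ≤ B ∧ B ≤ K * A + D

/-! Both inequalities come from one quantity, `gap`: the sum, over the relevant coordinates, of
differences of positions along the way from `x` to `y`, with ends of length `D` collapsed.
Collapsing is what makes the sum controllable. Coordinates in which one point lies far from both
ends are pairwise non-transverse (`Active.not_transverse`), and such a family has at most `(n + 1)²`
members, by containers and bounded height. In every other coordinate the truncated position takes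
one of two extreme values, where small errors vanish. Hence errors in `gap` are bounded
independently of the number of coordinates (`sum_le_of_not_active`).

Sum bounded by distance: each step of a discrete quasigeodesic changes `gap` by a bounded amount.

Distance bounded by sum: let the hull consist of the points coarsely between `x` and `y` in every
coordinate. By uniqueness, distant hull points `u`, `v` are far apart in some coordinate. A hull
point between them, near the middle in that coordinate, splits `gap` into two definite pieces with
bounded error (`InHull.exists_between`, `InHull.gap_add_gap_le`). Iterating ends at boundedly close
pairs, whose number is linear in `gap`.

Such intermediate points come from medians in `X`. Coordinatewise medians form a consistent tuple,
and consistent tuples are realized by points (`exists_realization`): a partial realization over a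
pairwise orthogonal family is improved boundedly often. -/

/-- `m` lies between `a` and `b` up to an additive error `c`. -/
def CoarselyBetween {M : Type*} [MetricSpace M] (c : ℝ) (a m b : M) : Prop :=
  dist a m + dist m b ≤ dist a b + c

/-! ### Coarse betweenness and medians in hyperbolic spaces. -/

section Geodesics

variable {M : Type*} [MetricSpace M]

theorem IsGeodesicOn.dist_add_dist {f : ℝ → M} {ℓ t : ℝ} (hf : IsGeodesicOn f ℓ)
    (ht : t ∈ Set.Icc (0 : ℝ) ℓ) :
    dist (f 0) (f t) = t ∧ dist (f t) (f ℓ) = ℓ - t ∧ dist (f 0) (f ℓ) = ℓ := by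
  have h0 : (0 : ℝ) ∈ Set.Icc (0 : ℝ) ℓ := ⟨le_rfl, hf.1⟩
  have hl : ℓ ∈ Set.Icc (0 : ℝ) ℓ := ⟨hf.1, le_rfl⟩
  refine ⟨?_, ?_, ?_⟩
  · rw [hf.2 0 h0 t ht, zero_sub, abs_neg, abs_of_nonneg ht.1]
  · rw [hf.2 t ht ℓ hl, abs_sub_comm, abs_of_nonneg (by linarith [ht.2])]
  · rw [hf.2 0 h0 ℓ hl, zero_sub, abs_neg, abs_of_nonneg hf.1]

theorem IsGeodesicOn.continuousOn {f : ℝ → M} {ℓ : ℝ} (hf : IsGeodesicOn f ℓ) :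
    ContinuousOn f (Set.Icc (0 : ℝ) ℓ) := by
  have : LipschitzOnWith 1 f (Set.Icc (0 : ℝ) ℓ) := by
    refine LipschitzOnWith.of_dist_le_mul fun s hs t ht => ?_
    rw [hf.2 s hs t ht, Real.dist_eq]
    simp
  exact this.continuousOn

theorem IsGeodesicSegment.dist_add_dist {γ : Set M} {a b p : M} (h : IsGeodesicSegment γ a b)
    (hp : p ∈ γ) : dist a p + dist p b = dist a b := by
  obtain ⟨f, ℓ, hf, rfl, rfl, rfl⟩ := h
  obtain ⟨t, ht, rfl⟩ := hp
  obtain ⟨h1, h2, h3⟩ := hf.dist_add_dist ht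
  rw [h1, h2, h3]; ring

theorem IsGeodesicSegment.left_mem {γ : Set M} {a b : M} (h : IsGeodesicSegment γ a b) :
    a ∈ γ := by
  obtain ⟨f, ℓ, hf, rfl, rfl, rfl⟩ := h
  exact ⟨0, ⟨le_rfl, hf.1⟩, rfl⟩

theorem IsGeodesicSegment.right_mem {γ : Set M} {a b : M} (h : IsGeodesicSegment γ a b) :
    b ∈ γ := by
  obtain ⟨f, ℓ, hf, rfl, rfl, rfl⟩ := h
  exact ⟨ℓ, ⟨hf.1, le_rfl⟩, rfl⟩

theorem exists_dist_lt_of_mem_cthickening {Y : Set M} {r : ℝ} (hr : 0 ≤ r) {p : M}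
    (hp : p ∈ Metric.cthickening r Y) : ∃ y ∈ Y, dist p y < r + 1 :=
  Metric.mem_thickening_iff.1
    (Metric.cthickening_subset_thickening' (by linarith) (by linarith) Y hp)

/-- On each side of a triangle in a hyperbolic space there is a coarse median of the vertices. -/
theorem IsHyperbolicSpace.exists_median {δ : ℝ} (hM : IsHyperbolicSpace M δ) (hδ : 0 ≤ δ)
    {f : ℝ → M} {ℓ : ℝ} (hf : IsGeodesicOn f ℓ) (c : M) :
    ∃ t ∈ Set.Icc (0 : ℝ) ℓ, CoarselyBetween (2 * (δ + 1)) (f 0) (f t) c ∧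
      CoarselyBetween (2 * (δ + 1)) (f ℓ) (f t) c := by
  obtain ⟨β, hβ⟩ := hM.1 (f ℓ) c
  obtain ⟨γ, hγ⟩ := hM.1 (f 0) c
  have hα : IsGeodesicSegment (f '' Set.Icc (0 : ℝ) ℓ) (f 0) (f ℓ) := ⟨f, ℓ, hf, rfl, rfl, rfl⟩
  have hthin := (hM.2 _ _ _ _ _ _ hα hβ hγ).1
  -- Balance the distances to the other two sides. Thinness makes one of them small at the balance
  -- point, hence both.
  have hcont : ContinuousOn (fun t => Metric.infDist (f t) γ - Metric.infDist (f t) β)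
      (Set.Icc (0 : ℝ) ℓ) :=
    ((Metric.continuous_infDist_pt γ).comp_continuousOn hf.continuousOn).sub
      ((Metric.continuous_infDist_pt β).comp_continuousOn hf.continuousOn)
  have hivt := intermediate_value_Icc hf.1 hcont
  have hmem : (0 : ℝ) ∈ Set.Icc (Metric.infDist (f 0) γ - Metric.infDist (f 0) β)
      (Metric.infDist (f ℓ) γ - Metric.infDist (f ℓ) β) := by
    rw [Metric.infDist_zero_of_mem hγ.left_mem, Metric.infDist_zero_of_mem hβ.left_mem]
    constructor
    · simpa using Metric.infDist_nonneg
    · simpa using Metric.infDist_nonneg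
  obtain ⟨t, ht, ht0⟩ := hivt hmem
  obtain ⟨y, hy, hyd⟩ := exists_dist_lt_of_mem_cthickening hδ (hthin ⟨t, ht, rfl⟩)
  have heq : Metric.infDist (f t) γ = Metric.infDist (f t) β := by
    simpa [sub_eq_zero] using ht0
  have hlt : Metric.infDist (f t) γ < δ + 1 ∧ Metric.infDist (f t) β < δ + 1 := by
    rcases hy with hy | hy
    · have := (Metric.infDist_le_dist_of_mem hy).trans_lt hyd
      exact ⟨heq ▸ this, this⟩
    · have := (Metric.infDist_le_dist_of_mem hy).trans_lt hyd
      exact ⟨this, heq ▸ this⟩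
  obtain ⟨g, hg, hgd⟩ := (Metric.infDist_lt_iff ⟨_, hγ.left_mem⟩).1 hlt.1
  obtain ⟨b, hb, hbd⟩ := (Metric.infDist_lt_iff ⟨_, hβ.left_mem⟩).1 hlt.2
  have h1 := hγ.dist_add_dist hg
  have h2 := hβ.dist_add_dist hb
  refine ⟨t, ht, ?_, ?_⟩ <;> unfold CoarselyBetween
  · have := dist_triangle (f 0) g (f t)
    have := dist_triangle (f t) g c
    rw [dist_comm g (f t)] at *
    linarith
  · have := dist_triangle (f ℓ) b (f t)
    have := dist_triangle (f t) b c
    rw [dist_comm b (f t)] at *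
    linarith

/-- If `u` is coarsely between `a` and `b`, then it is close to the coarse medians of `a`, `b`
and `u`. -/
theorem CoarselyBetween.dist_le_of_median {c e : ℝ} {a b u m : M} (hu : CoarselyBetween c a u b)
    (h1 : CoarselyBetween e a m u) (h2 : CoarselyBetween e b m u) :
    2 * dist u m ≤ c + 2 * e := by
  unfold CoarselyBetween at *
  have := dist_triangle a m b
  rw [dist_comm b m, dist_comm b u, dist_comm m u] at *
  linarith

theorem CoarselyBetween.of_dist_le {c e : ℝ} {a m m' b : M} (h : CoarselyBetween c a m b)
    (hm : dist m m' ≤ e) : CoarselyBetween (c + 2 * e) a m' b := by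
  unfold CoarselyBetween at *
  have := dist_triangle a m m'
  have := dist_triangle m' m b
  rw [dist_comm m' m] at *
  linarith

theorem CoarselyBetween.mono {c c' : ℝ} {a m b : M} (h : CoarselyBetween c a m b)
    (hc : c ≤ c') : CoarselyBetween c' a m b := by
  unfold CoarselyBetween at *
  linarith

theorem CoarselyBetween.symm {c : ℝ} {a m b : M} (h : CoarselyBetween c a m b) :
    CoarselyBetween c b m a := by
  unfold CoarselyBetween at *
  rw [dist_comm b m, dist_comm m a, dist_comm b a]
  linarith

/-- Each of `u`, `v` is close to its median on a geodesic from `a` to `b`, and points of a geodesic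
are determined by their distance from `a`. -/
theorem IsHyperbolicSpace.dist_le_abs_sub {δ : ℝ} (hM : IsHyperbolicSpace M δ) (hδ : 0 ≤ δ)
    {c : ℝ} {a b u v : M} (hu : CoarselyBetween c a u b) (hv : CoarselyBetween c a v b) :
    dist u v ≤ |dist a u - dist a v| + 2 * c + 8 * (δ + 1) := by
  obtain ⟨_, f, ℓ, hf, rfl, rfl, -⟩ := hM.1 a b
  obtain ⟨t, ht, h1, h2⟩ := hM.exists_median hδ hf u
  obtain ⟨t', ht', h1', h2'⟩ := hM.exists_median hδ hf v
  have hut := hu.dist_le_of_median h1 h2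
  have hvt := hv.dist_le_of_median h1' h2'
  have e1 := (hf.dist_add_dist ht).1
  have e2 := (hf.dist_add_dist ht').1
  have e3 := hf.2 t ht t' ht'
  have k1 := dist_triangle4 u (f t) (f t') v
  rw [dist_comm (f t') v] at k1
  have k2 : |t - t'| ≤ |t - dist (f 0) u| + |dist (f 0) u - dist (f 0) v|
      + |dist (f 0) v - t'| := by
    have := abs_sub_le t (dist (f 0) u) t'
    have := abs_sub_le (dist (f 0) u) (dist (f 0) v) t'
    linarith
  have k3 : |t - dist (f 0) u| ≤ dist u (f t) := by
    nth_rewrite 1 [← e1]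
    rw [dist_comm u (f t), dist_comm (f 0), dist_comm (f 0)]
    exact abs_dist_sub_le _ _ _
  have k4 : |dist (f 0) v - t'| ≤ dist v (f t') := by
    nth_rewrite 1 [← e2]
    rw [dist_comm (f 0), dist_comm (f 0)]
    exact abs_dist_sub_le _ _ _
  linarith

end Geodesics

section SetDist

variable {M : Type*} [MetricSpace M] {A B : Set M}

theorem setDist_le_dist {a b : M} (ha : a ∈ A) (hb : b ∈ B) : setDist A B ≤ dist a b :=
  csInf_le ⟨0, by rintro _ ⟨x, -, y, -, rfl⟩; exact dist_nonneg⟩ ⟨a, ha, b, hb, rfl⟩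

theorem dist_le_setDist_add {a b : M} {r r' : ℝ} (ha : a ∈ A) (hb : b ∈ B) (hA : DiamLE A r)
    (hB : DiamLE B r') : dist a b ≤ setDist A B + (r + r') := by
  rw [← sub_le_iff_le_add]
  refine le_csInf ⟨_, a, ha, b, hb, rfl⟩ ?_
  rintro _ ⟨x, hx, y, hy, rfl⟩
  have := dist_triangle4 a x y b
  linarith [hA a ha x hx, hB y hy b hb]

end SetDist

/-! ### Heights in orders with bounded chains. -/

section Order

/-- A partial order whose chains have bounded cardinality has a bounded strictly monotone
height function. -/
theorem exists_height_of_chain_bound {𝔖 : Type*} [PartialOrder 𝔖] {n : ℕ}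
    (h : ∀ c : Set 𝔖, IsChain (· ≤ ·) c → c.encard ≤ n) :
    ∃ ht : 𝔖 → ℕ, StrictMono ht ∧ ∀ V, ht V ≤ n := by
  have hle : ∀ V : 𝔖, Order.height V ≤ n := by
    intro V
    refine Order.height_le fun p _ => ?_
    have hc : IsChain (· ≤ ·) (Set.range p) := by
      rintro _ ⟨i, rfl⟩ _ ⟨j, rfl⟩ _
      rcases le_total i j with hij | hij
      · exact Or.inl (p.monotone hij)
      · exact Or.inr (p.monotone hij)
    have h1 := h _ hc
    rw [← Set.image_univ, p.strictMono.injective.encard_image, Set.encard_univ] at h1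
    simp only [ENat.card_eq_coe_fintype_card, Fintype.card_fin] at h1
    refine le_trans ?_ h1
    exact_mod_cast Nat.le_succ _
  have htop : ∀ V : 𝔖, Order.height V ≠ ⊤ := fun V hV => by
    have := hle V
    rw [hV] at this
    simp at this
  refine ⟨fun V => (Order.height V).toNat, fun V W hVW => ?_, fun V => ?_⟩
  · have := Order.height_strictMono hVW (lt_top_iff_ne_top.2 (htop V))
    rw [← ENat.natCast_toNat (htop V), ← ENat.natCast_toNat (htop W)] at this
    exact_mod_cast this
  · have := hle V
    rw [← ENat.natCast_toNat (htop V)] at this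
    exact_mod_cast this

theorem exists_isMax_ge_of_height {𝔖 : Type*} [PartialOrder 𝔖] {n : ℕ} {ht : 𝔖 → ℕ}
    (hmono : StrictMono ht) (hle : ∀ V, ht V ≤ n) (V : 𝔖) : ∃ S, V ≤ S ∧ IsMax S := by
  induction hk : n - ht V using Nat.strong_induction_on generalizing V with
  | _ k ih =>
    by_cases hV : IsMax V
    · exact ⟨V, le_rfl, hV⟩
    · obtain ⟨W, hW⟩ := not_isMax_iff.1 hV
      have := hmono hW
      have := hle W
      obtain ⟨S, hS, hmax⟩ := ih (n - ht W) (by omega) W rfl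
      exact ⟨S, hW.le.trans hS, hmax⟩

end Order

/-! ### Reduction to point-valued projections and a single constant. -/

/-- Neither orthogonal nor comparable. -/
def IsTransverse {𝔖 : Type*} [PartialOrder 𝔖] (orth : 𝔖 → 𝔖 → Prop) (V W : 𝔖) : Prop :=
  ¬ orth V W ∧ ¬ V ≤ W ∧ ¬ W ≤ V

/-- A hierarchically hyperbolic space in which all projections have been replaced by points and
all constants by a single one. Only those consequences of hyperbolicity are kept which enter the
distance formula. -/
structure PointedHierarchy (X : Type*) [MetricSpace X] (𝔖 : Type*) [PartialOrder 𝔖]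
    (C : 𝔖 → Type*) [∀ W, MetricSpace (C W)] where
  pt : ∀ W : 𝔖, X → C W
  image : ∀ W : 𝔖, Set (C W)
  orth : 𝔖 → 𝔖 → Prop
  rho : 𝔖 → ∀ W : 𝔖, C W
  down : ∀ W V : 𝔖, C W → C V
  ht : 𝔖 → ℕ
  n : ℕ
  B : ℝ
  one_le_B : 1 ≤ B
  ht_strictMono : StrictMono ht
  ht_le : ∀ V, ht V ≤ n
  exists_path : ∀ x y : X, ∃ (N : ℕ) (z : ℕ → X), (N : ℝ) ≤ B * dist x y + B ∧ z 0 = x ∧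
    z N = y ∧ ∀ i < N, dist (z i) (z (i + 1)) ≤ B
  pt_mem : ∀ W x, pt W x ∈ image W
  lipschitz : ∀ W x y, dist (pt W x) (pt W y) ≤ B * dist x y + B
  median : ∀ W x y z, ∃ m ∈ image W, CoarselyBetween B (pt W x) m (pt W y) ∧
    CoarselyBetween B (pt W x) m (pt W z) ∧ CoarselyBetween B (pt W y) m (pt W z)
  midpoint : ∀ W x y, ∃ z, dist (pt W x) (pt W z) ≤ dist (pt W x) (pt W y) / 2 + B ∧
    dist (pt W z) (pt W y) ≤ dist (pt W x) (pt W y) / 2 + B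
  dist_le_abs_sub : ∀ (W : 𝔖) (c : ℝ) (a b u v : C W), CoarselyBetween c a u b →
    CoarselyBetween c a v b → dist u v ≤ |dist a u - dist a v| + 2 * c + B
  exists_top : Nonempty 𝔖 → ∃ S : 𝔖, ∀ V, V ≤ S
  orth_symm : ∀ V W, orth V W → orth W V
  orth_of_nested : ∀ V W U, V ≤ W → orth W U → orth V U
  orth_container : ∀ T U, U ≤ T → (∃ V, V ≤ T ∧ orth V U) →
    ∃ W, W < T ∧ ∀ V, orth V U → V ≤ T → V ≤ W
  orth_not_comparable : ∀ V W, orth V W → ¬ V ≤ W ∧ ¬ W ≤ V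
  consistency_transverse : ∀ V W, IsTransverse orth V W → ∀ x,
    dist (pt W x) (rho V W) ≤ B ∨ dist (pt V x) (rho W V) ≤ B
  consistency_nested : ∀ V W, V < W → ∀ x,
    dist (pt W x) (rho V W) ≤ B ∨ dist (pt V x) (down W V (pt W x)) ≤ B
  rho_close : ∀ U V W, U ≤ V → IsTransverse orth V W → ¬ orth W U →
    dist (rho U W) (rho V W) ≤ B
  finite_relevant : ∀ x y, {W | B ≤ dist (pt W x) (pt W y)}.Finite
  bounded_geodesic_image : ∀ V W, V < W → ∀ a b : C W,
    dist (down W V a) (down W V b) ≤ B ∨ CoarselyBetween B a (rho V W) b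
  partial_realization : ∀ 𝒱 : Set 𝔖, 𝒱.Pairwise orth → ∀ p : (∀ V, C V),
    (∀ V ∈ 𝒱, p V ∈ image V) → ∃ x : X, ∀ V ∈ 𝒱, dist (pt V x) (p V) ≤ B ∧
      ∀ W, V < W ∨ IsTransverse orth V W → dist (pt W x) (rho V W) ≤ B
  uniqueness : ∀ κ : ℝ, ∃ θ : ℝ, ∀ x y : X, θ ≤ dist x y →
    ∃ V, κ ≤ dist (pt V x) (pt V y)

/-- The quasigeodesic is sampled at `⌈L⌉₊` equal steps of length at most 1, and its lower bound
controls `L`. If `L = 0` there is no step and the ends coincide. -/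
theorem IsQuasigeodesicSpace.exists_path {X : Type*} [MetricSpace X] {q : ℝ}
    (hX : IsQuasigeodesicSpace X q) (hq : 1 ≤ q) (x y : X) :
    ∃ (N : ℕ) (z : ℕ → X), (N : ℝ) ≤ q * dist x y + q ^ 2 + 1 ∧ z 0 = x ∧
      z N = y ∧ ∀ i < N, dist (z i) (z (i + 1)) ≤ 2 * q := by
  obtain ⟨f, L, hL, rfl, rfl, hf⟩ := hX x y
  have hq0 : 0 < q := by linarith
  have h1 := (hf 0 ⟨le_rfl, hL⟩ L ⟨hL, le_rfl⟩).1
  rw [zero_sub, abs_neg, abs_of_nonneg hL] at h1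
  have hLq : L ≤ q * dist (f 0) (f L) + q ^ 2 := by
    have := mul_le_mul_of_nonneg_left h1 hq0.le
    have e : q * (q⁻¹ * L - q) = L - q ^ 2 := by field_simp
    linarith
  refine ⟨⌈L⌉₊, fun i => f (L * (i / ⌈L⌉₊)), ?_, by simp, ?_, fun i hi => ?_⟩
  · have := (Nat.ceil_lt_add_one hL).le
    linarith
  · rcases hL.eq_or_lt with h | h
    · simp [← h]
    · have : (⌈L⌉₊ : ℝ) ≠ 0 := by
        have := Nat.ceil_pos.2 h
        positivity
      simp [div_self this]
  · have hN : (0 : ℝ) < ⌈L⌉₊ := by exact_mod_cast (Nat.zero_le i).trans_lt hi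
    have hmem : ∀ j : ℕ, j ≤ ⌈L⌉₊ → L * ((j : ℝ) / ⌈L⌉₊) ∈ Set.Icc (0 : ℝ) L := fun j hj => by
      have : (j : ℝ) / ⌈L⌉₊ ≤ 1 := by
        rw [div_le_one hN]
        exact_mod_cast hj
      exact ⟨by positivity, mul_le_of_le_one_right hL this⟩
    have h2 := (hf _ (hmem i hi.le) _ (hmem (i + 1) hi)).2
    have h3 : |L * ((i : ℝ) / ⌈L⌉₊) - L * (((i + 1 : ℕ) : ℝ) / ⌈L⌉₊)| ≤ 1 := by
      have : L * ((i : ℝ) / ⌈L⌉₊) - L * (((i + 1 : ℕ) : ℝ) / ⌈L⌉₊) = - (L / ⌈L⌉₊) := by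
        push_cast
        field_simp
        ring
      rw [this, abs_neg, abs_of_nonneg (by positivity), div_le_one hN]
      exact Nat.le_ceil L
    have := mul_le_mul_of_nonneg_left h3 hq0.le
    linarith

namespace HierarchicallyHyperbolicSpace

variable {X : Type*} [MetricSpace X] {𝔖 : Type*} [PartialOrder 𝔖] {C : 𝔖 → Type*}
  [∀ W, MetricSpace (C W)] (H : HierarchicallyHyperbolicSpace X 𝔖 C)

theorem E_nonneg : 0 ≤ H.E := H.κ₀_nonneg.trans ((le_max_right _ _).trans H.max_le_E)

theorem exists_top (H : HierarchicallyHyperbolicSpace X 𝔖 C) (h : Nonempty 𝔖) : ∃ S : 𝔖, ∀ V, V ≤ S := by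
  obtain ⟨ht, hmono, hle⟩ := exists_height_of_chain_bound H.finite_complexity
  obtain ⟨S, -, huniq⟩ := H.unique_maximal h
  refine ⟨S, fun V => ?_⟩
  obtain ⟨S', hV, hS'⟩ := exists_isMax_ge_of_height hmono hle V
  exact huniq S' hS' ▸ hV

/-- Induction on height: by large links, a coordinate properly nested in `W` with distance at least
`E` lies below one of finitely many elements, all of smaller height than `W`. -/
theorem finite_setOf_le_projDist (x y : X) : {W : 𝔖 | H.E ≤ H.projDist W x y}.Finite := by
  obtain ⟨ht, hmono, -⟩ := exists_height_of_chain_bound H.finite_complexity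
  have key : ∀ (k : ℕ) (W : 𝔖), ht W = k →
      {T : 𝔖 | T ≤ W ∧ H.E ≤ H.projDist T x y}.Finite := by
    intro k
    induction k using Nat.strong_induction_on with
    | _ k ih =>
      intro W hW
      obtain ⟨𝒯, -, h1, h2⟩ := H.large_links W x y
      refine Set.Finite.subset (Set.Finite.union (Set.finite_singleton W)
        (Set.Finite.biUnion 𝒯.finite_toSet fun T hT =>
          ih (ht T) (hW ▸ hmono (h1 T hT).1) T rfl)) ?_
      rintro T ⟨hTW, hT⟩
      rcases hTW.eq_or_lt with h | h
      · exact Or.inl h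
      · rcases h2 T h with ⟨T', hT', hle⟩ | hlt
        · exact Or.inr (Set.mem_biUnion hT' ⟨hle, hT⟩)
        · exact absurd hT (not_le.2 hlt)
  rcases isEmpty_or_nonempty 𝔖 with h | h
  · exact Set.toFinite _
  · obtain ⟨S, hS⟩ := H.exists_top h
    exact (key _ S rfl).subset fun T hT => ⟨hS T, hT⟩

open Classical in
/-- A point of `ρ^V_W`, where this set is nonempty. -/
noncomputable def rhoPoint (x₀ : X) (V W : 𝔖) : C W :=
  if h : (H.rho V W).Nonempty then h.some else (H.proj_nonempty W x₀).some

open Classical in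
/-- A point of `ρ^W_V(p)`, where this set is nonempty. -/
noncomputable def downPoint (x₀ : X) (W V : 𝔖) (p : C W) : C V :=
  if h : (H.rhoDown W V p).Nonempty then h.some else (H.proj_nonempty V x₀).some

theorem rhoPoint_mem (x₀ : X) {V W : 𝔖} (h : (H.rho V W).Nonempty) :
    H.rhoPoint x₀ V W ∈ H.rho V W := by
  rw [rhoPoint, dif_pos h]
  exact h.some_mem

theorem downPoint_mem (x₀ : X) {V W : 𝔖} (h : V < W) (p : C W) :
    H.downPoint x₀ W V p ∈ H.rhoDown W V p := by
  have h := H.rhoDown_nonempty V W h p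
  rw [downPoint, dif_pos h]
  exact h.some_mem

theorem exists_mem_proj_dist_lt {W : 𝔖} {x y : X} {a b : C W} (ha : a ∈ H.proj W x)
    (hb : b ∈ H.proj W y) {f : ℝ → C W} {ℓ t : ℝ} (hf : IsGeodesicOn f ℓ) (h0 : f 0 = a)
    (hl : f ℓ = b) (ht : t ∈ Set.Icc (0 : ℝ) ℓ) :
    ∃ z, ∃ p ∈ H.proj W z, dist (f t) p < H.K + 1 := by
  have := H.proj_quasiconvex W a (Set.mem_iUnion.2 ⟨x, ha⟩) b (Set.mem_iUnion.2 ⟨y, hb⟩) _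
    ⟨f, ℓ, hf, h0, hl, rfl⟩ ⟨t, ht, rfl⟩
  obtain ⟨p, hp, hd⟩ := exists_dist_lt_of_mem_cthickening H.K_nonneg this
  obtain ⟨z, hz⟩ := Set.mem_iUnion.1 hp
  exact ⟨z, p, hz, hd⟩

/-- One point is chosen from each set. This changes distances by at most the diameters, which `B`
absorbs along with all other constants. Quasiconvexity moves medians and midpoints of geodesics into
the image of the projection. -/
theorem exists_pointedHierarchy (x₀ : X) : ∃ P : PointedHierarchy X 𝔖 C, ∀ W x y,
    H.projDist W x y ≤ dist (P.pt W x) (P.pt W y) ∧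
      dist (P.pt W x) (P.pt W y) ≤ H.projDist W x y + P.B := by
  obtain ⟨ht, hmono, hle⟩ := exists_height_of_chain_bound H.finite_complexity
  set B : ℝ := 20 * (1 + H.δ + H.ξ + H.K + H.κ₀ + H.E + |H.α| + H.q + H.q ^ 2) with hB
  have hδ := H.δ_nonneg
  have hξ := H.ξ_nonneg
  have hK := H.K_nonneg
  have hκ := H.κ₀_nonneg
  have hE := H.E_nonneg
  have hα := abs_nonneg H.α
  have hα' := le_abs_self H.α
  have hq := H.one_le_q
  have hq2 := sq_nonneg H.q
  set pt : ∀ W : 𝔖, X → C W := fun W x => (H.proj_nonempty W x).some with hpt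
  have pt_mem : ∀ W x, pt W x ∈ H.proj W x := fun W x => (H.proj_nonempty W x).some_mem
  have hlo : ∀ W x y, H.projDist W x y ≤ dist (pt W x) (pt W y) := fun W x y =>
    setDist_le_dist (pt_mem W x) (pt_mem W y)
  have hup : ∀ W x y, dist (pt W x) (pt W y) ≤ H.projDist W x y + (H.ξ + H.ξ) := fun W x y =>
    dist_le_setDist_add (pt_mem W x) (pt_mem W y) (H.proj_diam W x) (H.proj_diam W y)
  have hB1 : 1 ≤ B := by linarith
  have hup' : ∀ W x y, dist (pt W x) (pt W y) ≤ H.projDist W x y + B := fun W x y => by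
    have := hup W x y
    linarith
  have rho_trans : ∀ V W, IsTransverse H.orth V W →
      H.rhoPoint x₀ V W ∈ H.rho V W ∧ DiamLE (H.rho V W) H.ξ := fun V W h =>
    ⟨H.rhoPoint_mem x₀ (H.rho_transverse_nonempty V W h.1 h.2.1 h.2.2),
      H.rho_transverse_diam V W h.1 h.2.1 h.2.2⟩
  have rho_nest : ∀ V W, V < W →
      H.rhoPoint x₀ V W ∈ H.rho V W ∧ DiamLE (H.rho V W) H.ξ := fun V W h =>
    ⟨H.rhoPoint_mem x₀ (H.rho_nested_nonempty V W h), H.rho_nested_diam V W h⟩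
  have trans_symm : ∀ V W, IsTransverse H.orth V W → IsTransverse H.orth W V := fun V W h =>
    ⟨fun h' => h.1 (H.orth_symm _ _ h'), h.2.2, h.2.1⟩
  refine ⟨{
    pt := pt
    image := fun W => ⋃ x, H.proj W x
    orth := H.orth
    rho := H.rhoPoint x₀
    down := H.downPoint x₀
    ht := ht
    n := H.n
    B := B
    one_le_B := hB1
    ht_strictMono := hmono
    ht_le := hle
    exists_path := ?_
    pt_mem := fun W x => Set.mem_iUnion.2 ⟨x, pt_mem W x⟩
    lipschitz := ?_
    median := ?_
    midpoint := ?_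
    dist_le_abs_sub := ?_
    exists_top := H.exists_top
    orth_symm := H.orth_symm
    orth_of_nested := H.orth_of_nested
    orth_container := H.orth_container
    orth_not_comparable := H.orth_not_comparable
    consistency_transverse := ?_
    consistency_nested := ?_
    rho_close := ?_
    finite_relevant := ?_
    bounded_geodesic_image := ?_
    partial_realization := ?_
    uniqueness := ?_ }, fun W x y => ⟨hlo W x y, hup' W x y⟩⟩
  · intro x y
    obtain ⟨N, z, h1, h2, h3, h4⟩ := H.quasigeodesic.exists_path hq x y
    refine ⟨N, z, ?_, h2, h3, fun i hi => (h4 i hi).trans (by linarith)⟩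
    have : H.q * dist x y ≤ B * dist x y :=
      mul_le_mul_of_nonneg_right (by linarith) dist_nonneg
    linarith
  · intro W x y
    have h1 := hup W x y
    have h2 : H.projDist W x y ≤ H.K * dist x y + H.K := H.proj_lipschitz W x y
    have : H.K * dist x y ≤ B * dist x y :=
      mul_le_mul_of_nonneg_right (by linarith) dist_nonneg
    linarith
  · intro W x y z
    obtain ⟨_, f, ℓ, hf, h0, hl, -⟩ := (H.hyperbolic W).1 (pt W x) (pt W y)
    obtain ⟨t, htm, h1, h2⟩ := (H.hyperbolic W).exists_median hδ hf (pt W z)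
    obtain ⟨w, p, hp, hd⟩ := H.exists_mem_proj_dist_lt (pt_mem W x) (pt_mem W y) hf h0 hl htm
    have h3 : CoarselyBetween 0 (f 0) (f t) (f ℓ) := by
      obtain ⟨e1, e2, e3⟩ := hf.dist_add_dist htm
      unfold CoarselyBetween
      linarith
    rw [h0] at h1 h3
    rw [hl] at h2 h3
    exact ⟨p, Set.mem_iUnion.2 ⟨w, hp⟩, (h3.of_dist_le hd.le).mono (by linarith),
      (h1.of_dist_le hd.le).mono (by linarith), (h2.of_dist_le hd.le).mono (by linarith)⟩
  · intro W x y
    obtain ⟨_, f, ℓ, hf, h0, hl, -⟩ := (H.hyperbolic W).1 (pt W x) (pt W y)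
    have htm : ℓ / 2 ∈ Set.Icc (0 : ℝ) ℓ := ⟨by linarith [hf.1], by linarith [hf.1]⟩
    obtain ⟨w, p, hp, hd⟩ := H.exists_mem_proj_dist_lt (pt_mem W x) (pt_mem W y) hf h0 hl htm
    obtain ⟨e1, e2, e3⟩ := hf.dist_add_dist htm
    have hpw := H.proj_diam W w p hp _ (pt_mem W w)
    rw [h0] at e1 e3
    rw [hl] at e2 e3
    refine ⟨w, ?_, ?_⟩
    · have := dist_triangle4 (pt W x) (f (ℓ / 2)) p (pt W w)
      linarith
    · have := dist_triangle4 (pt W w) p (f (ℓ / 2)) (pt W y)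
      rw [dist_comm p (f _), dist_comm _ p] at this
      linarith
  · intro W c a b u v hu hv
    have := (H.hyperbolic W).dist_le_abs_sub hδ hu hv
    linarith
  · intro V W h x
    obtain ⟨h1, h2⟩ := rho_trans V W h
    obtain ⟨h3, h4⟩ := rho_trans W V (trans_symm V W h)
    rcases min_le_iff.1 (H.consistency_transverse V W h.1 h.2.1 h.2.2 x) with h5 | h5
    · left
      have := dist_le_setDist_add (pt_mem W x) h1 (H.proj_diam W x) h2
      linarith
    · right
      have := dist_le_setDist_add (pt_mem V x) h3 (H.proj_diam V x) h4
      linarith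
  · intro V W h x
    obtain ⟨h1, h2⟩ := rho_nest V W h
    rcases H.consistency_nested V W h x with h5 | h5
    · left
      have := dist_le_setDist_add (pt_mem W x) h1 (H.proj_diam W x) h2
      linarith
    · right
      have := h5 _ (Or.inl (pt_mem V x)) (H.downPoint x₀ W V (pt W x))
        (Or.inr (Set.mem_biUnion (pt_mem W x) (H.downPoint_mem x₀ h _)))
      linarith
  · intro U V W hUV hVW hWU
    obtain ⟨h1, h2⟩ := rho_trans V W hVW
    -- `U` is properly nested in `W` or transverse to it, so that `ρ^U_W` is meaningful.
    have h3 : H.rhoPoint x₀ U W ∈ H.rho U W ∧ DiamLE (H.rho U W) H.ξ := by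
      have hWU' : ¬ W ≤ U := fun h => hVW.2.2 (h.trans hUV)
      by_cases h : U ≤ W
      · exact rho_nest U W (lt_of_le_not_ge h hWU')
      · exact rho_trans U W ⟨fun h' => hWU (H.orth_symm _ _ h'), h, hWU'⟩
    have h4 := H.rho_close U V W hUV (Or.inr ⟨hVW, hWU⟩)
    have := dist_le_setDist_add h3.1 h1 h3.2 h2
    linarith
  · intro x y
    refine (H.finite_setOf_le_projDist x y).subset fun W hW => ?_
    have := hup W x y
    have hW : B ≤ dist (pt W x) (pt W y) := hW
    show H.E ≤ H.projDist W x y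
    linarith
  · intro V W h a b
    obtain ⟨γ, hγ⟩ := (H.hyperbolic W).1 a b
    obtain ⟨h1, h2⟩ := rho_nest V W h
    rcases H.bounded_geodesic_image V W h a b γ hγ with h5 | ⟨g, hg, hg'⟩
    · left
      have := h5 _ (Set.mem_biUnion hγ.left_mem (H.downPoint_mem x₀ h a)) _
        (Set.mem_biUnion hγ.right_mem (H.downPoint_mem x₀ h b))
      linarith
    · right
      obtain ⟨y, hy, hd⟩ := exists_dist_lt_of_mem_cthickening hE hg'
      have h6 := h2 y hy _ h1
      have h7 := hγ.dist_add_dist hg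
      have h8 : CoarselyBetween 0 a g b := by unfold CoarselyBetween; linarith
      have h9 : dist g (H.rhoPoint x₀ V W) ≤ H.E + 1 + H.ξ := by
        have := dist_triangle g y (H.rhoPoint x₀ V W)
        linarith
      exact (h8.of_dist_le h9).mono (by linarith)
  · intro 𝒱 h𝒱 p hp
    obtain ⟨x, hx⟩ := H.partial_realization 𝒱 h𝒱 (fun V => p V) (fun V => hp V V.2)
    refine ⟨x, fun V hV => ?_⟩
    obtain ⟨h1, h2, h3⟩ := hx ⟨V, hV⟩
    refine ⟨?_, fun W hW => ?_⟩
    · have hsing : DiamLE ({p V} : Set (C V)) 0 := by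
        rintro a rfl b rfl
        simp
      have := dist_le_setDist_add (pt_mem V x) (Set.mem_singleton (p V)) (H.proj_diam V x) hsing
      linarith
    · rcases hW with hW | hW
      · obtain ⟨h4, h5⟩ := rho_nest V W hW
        have := dist_le_setDist_add (pt_mem W x) h4 (H.proj_diam W x) h5
        linarith [h2 W hW]
      · obtain ⟨h4, h5⟩ := rho_trans V W hW
        have := dist_le_setDist_add (pt_mem W x) h4 (H.proj_diam W x) h5
        linarith [h3 W (fun h' => hW.1 (H.orth_symm _ _ h')) hW.2.2 hW.2.1]
  · intro κ
    obtain ⟨θ, hθ⟩ := H.uniqueness (max κ 0) (le_max_right _ _)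
    refine ⟨θ, fun x y hxy => ?_⟩
    obtain ⟨V, hV⟩ := hθ x y hxy
    exact ⟨V, (le_max_left _ _).trans (hV.trans (hlo V x y))⟩

end HierarchicallyHyperbolicSpace

/-! ### Realization of consistent tuples. -/

theorem Set.Finite.exists_not_rel {α : Type*} {s : Set α} (hs : s.Finite) (hne : s.Nonempty)
    {r : α → α → Prop} (hirr : ∀ a ∈ s, ¬ r a a)
    (htrans : ∀ a ∈ s, ∀ b ∈ s, ∀ c ∈ s, r a b → r b c → r a c) :
    ∃ m ∈ s, ∀ a ∈ s, ¬ r a m := by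
  induction s, hs using Set.Finite.induction_on with
  | empty => exact absurd hne Set.not_nonempty_empty
  | @insert a s _ _ ih =>
    rcases s.eq_empty_or_nonempty with rfl | h
    · exact ⟨a, by simp, by simpa using hirr⟩
    · obtain ⟨m, hm, hmin⟩ := ih h (fun x hx => hirr x (Or.inr hx))
        (fun x hx y hy z hz => htrans x (Or.inr hx) y (Or.inr hy) z (Or.inr hz))
      by_cases ham : r a m
      · refine ⟨a, Or.inl rfl, ?_⟩
        rintro x (rfl | hx) hxa
        · exact hirr _ (Or.inl rfl) hxa
        · exact hmin x hx (htrans x (Or.inr hx) a (Or.inl rfl) m (Or.inr hm) hxa ham)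
      · refine ⟨m, Or.inr hm, ?_⟩
        rintro x (rfl | hx)
        · exact ham
        · exact hmin x hx

namespace PointedHierarchy

variable {X : Type*} [MetricSpace X] {𝔖 : Type*} [PartialOrder 𝔖] {C : 𝔖 → Type*}
  [∀ W, MetricSpace (C W)] (P : PointedHierarchy X 𝔖 C)

theorem isTransverse_symm {V W : 𝔖} (h : IsTransverse P.orth V W) : IsTransverse P.orth W V :=
  ⟨fun h' => h.1 (P.orth_symm _ _ h'), h.2.2, h.2.1⟩

/-- Once `U` is removed, the other elements lie in the container of what is orthogonal to `U` in
`T`, which has smaller height. -/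
theorem card_le_of_pairwise_orth (s : Finset 𝔖) (hs : (s : Set 𝔖).Pairwise P.orth) {T : 𝔖}
    (hT : ∀ V ∈ s, V ≤ T) : s.card ≤ P.ht T + 1 := by
  classical
  induction s using Finset.induction_on generalizing T with
  | empty => simp
  | @insert U s hU ih =>
    rw [Finset.card_insert_of_notMem hU]
    rcases s.eq_empty_or_nonempty with rfl | ⟨V, hV⟩
    · simp
    · have horth : ∀ V ∈ s, P.orth V U := fun V hV =>
        hs (by simp [hV]) (by simp) (fun h => hU (h ▸ hV))
      obtain ⟨W, hWT, hW⟩ := P.orth_container T U (hT U (by simp))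
        ⟨V, hT V (by simp [hV]), horth V hV⟩
      have h1 := ih (hs.mono (by simp)) (T := W)
        (fun V hV => hW V (horth V hV) (hT V (by simp [hV])))
      have := P.ht_strictMono hWT
      omega

theorem card_le_of_orth (s : Finset 𝔖) (hs : (s : Set 𝔖).Pairwise P.orth) :
    s.card ≤ P.n + 1 := by
  rcases s.eq_empty_or_nonempty with rfl | ⟨V, hV⟩
  · simp
  · obtain ⟨S, hS⟩ := P.exists_top ⟨V⟩
    have := P.card_le_of_pairwise_orth s hs (T := S) (fun V _ => hS V)
    have := P.ht_le S
    omega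

/-- Distinct elements of equal height are incomparable, hence here orthogonal. There are `n + 1`
heights with at most `n + 1` elements each. -/
theorem card_le_of_not_transverse (s : Finset 𝔖)
    (hs : ∀ V ∈ s, ∀ W ∈ s, ¬ IsTransverse P.orth V W) : s.card ≤ (P.n + 1) * (P.n + 1) := by
  have := Finset.card_le_mul_card_image_of_maps_to (s := s) (t := Finset.range (P.n + 1))
    (f := P.ht) (fun V _ => Finset.mem_range.2 (Nat.lt_succ_of_le (P.ht_le V))) (P.n + 1) ?_
  · simpa using this
  · intro k _
    refine P.card_le_of_orth _ fun V hV W hW hne => ?_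
    simp only [Finset.coe_filter, Set.mem_ofPred_eq] at hV hW
    by_contra horth
    refine hs V hV.1 W hW.1 ⟨horth, fun h => ?_, fun h => ?_⟩
    · have := P.ht_strictMono (lt_of_le_of_ne h hne)
      omega
    · have := P.ht_strictMono (lt_of_le_of_ne h hne.symm)
      omega

/-- A tuple of points in the images of the projections which satisfies the consistency
inequalities and differs substantially from any given point of `X` in finitely many places. -/
structure Consistent (κ : ℝ) (b : ∀ W, C W) : Prop where
  mem : ∀ W, b W ∈ P.image W
  transverse : ∀ V W, IsTransverse P.orth V W →
    dist (b W) (P.rho V W) ≤ κ ∨ dist (b V) (P.rho W V) ≤ κ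
  nested : ∀ V W, V < W →
    dist (b W) (P.rho V W) ≤ κ ∨ dist (b V) (P.down W V (b W)) ≤ κ
  finite : ∀ x, {W | 10 * κ < dist (P.pt W x) (b W)}.Finite

/-- The tuple `b` looks as if partially realized at `V`. -/
def Pinned (c : ℝ) (b : ∀ W, C W) (V : 𝔖) : Prop :=
  ∀ W, V < W ∨ IsTransverse P.orth V W → dist (b W) (P.rho V W) ≤ c

variable {P}

theorem exists_partial_realization_singleton (x : X) (V : 𝔖) :
    ∃ p : X, ∀ W, V < W ∨ IsTransverse P.orth V W → dist (P.pt W p) (P.rho V W) ≤ P.B := by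
  obtain ⟨p, hp⟩ := P.partial_realization {V} (Set.pairwise_singleton _ _) (fun W => P.pt W x)
    (fun W _ => P.pt_mem W x)
  exact ⟨p, (hp V rfl).2⟩

/-- A point realizing `T₁` and `T₃` simultaneously projects near both sets of `C T₂`. -/
theorem dist_rho_le_of_orth (x : X) {T₁ T₂ T₃ : 𝔖} (h13 : P.orth T₁ T₃)
    (h12 : IsTransverse P.orth T₁ T₂) (h32 : IsTransverse P.orth T₃ T₂) :
    dist (P.rho T₁ T₂) (P.rho T₃ T₂) ≤ 2 * P.B := by
  obtain ⟨p, hp⟩ := P.partial_realization {T₁, T₃}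
    (Set.pairwise_pair.2 fun _ => ⟨h13, P.orth_symm _ _ h13⟩) (fun W => P.pt W x)
    (fun W _ => P.pt_mem W x)
  have h1 := (hp T₁ (by simp)).2 T₂ (Or.inr h12)
  have h3 := (hp T₃ (by simp)).2 T₂ (Or.inr h32)
  have := dist_triangle_left (P.rho T₁ T₂) (P.rho T₃ T₂) (P.pt T₂ p)
  linarith

/-- If a transverse pair of coordinates separates `x` from `b`, then `b` determines the position
of `x` relative to this pair. -/
theorem dist_rho_le_of_separated {κ c : ℝ} {b : ∀ W, C W} {x : X} {T T' : 𝔖}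
    (hc : κ + P.B ≤ c) (hT' : c < dist (P.pt T' x) (b T')) (h : IsTransverse P.orth T T')
    (hb : dist (b T') (P.rho T T') ≤ κ) : dist (P.pt T x) (P.rho T' T) ≤ P.B := by
  rcases P.consistency_transverse T T' h x with h1 | h1
  · have := dist_triangle_right (P.pt T' x) (b T') (P.rho T T')
    linarith
  · exact h1

/-- The relation means that, on the way from `x` to `b`, the coordinate `T'` is crossed before `T`.
In `C T₂`, `b` is near the trace of `T₁` and `x` near that of `T₃`. These traces are therefore far
apart, which excludes orthogonality of `T₁` and `T₃`. If the order of `T₁` and `T₃` were reversed, a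
point realized at `T₁` would violate consistency for `T₂`, `T₃`. -/
theorem Consistent.rel_trans {κ c : ℝ} {b : ∀ W, C W} (hb : P.Consistent κ b) (hκ : P.B ≤ κ)
    (hc : 10 * κ ≤ c) {x : X} {T₁ T₂ T₃ : 𝔖} (h1 : c < dist (P.pt T₁ x) (b T₁))
    (h2 : c < dist (P.pt T₂ x) (b T₂)) (h3 : c < dist (P.pt T₃ x) (b T₃))
    (h13 : T₁ ≤ T₃ → T₁ = T₃) (h31 : T₃ ≤ T₁ → T₁ = T₃)
    (h12 : IsTransverse P.orth T₁ T₂) (h12' : dist (b T₂) (P.rho T₁ T₂) ≤ κ)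
    (h23 : IsTransverse P.orth T₂ T₃) (h23' : dist (b T₃) (P.rho T₂ T₃) ≤ κ) :
    IsTransverse P.orth T₁ T₃ ∧ dist (b T₃) (P.rho T₁ T₃) ≤ κ := by
  have hB := P.one_le_B
  have hx2 := dist_rho_le_of_separated (by linarith) h3 h23 h23'
  have hfar : 10 * κ - κ - P.B < dist (P.rho T₁ T₂) (P.rho T₃ T₂) := by
    have := dist_triangle4 (P.pt T₂ x) (P.rho T₃ T₂) (P.rho T₁ T₂) (b T₂)
    rw [dist_comm (P.rho T₃ T₂), dist_comm (P.rho T₁ T₂) (b T₂)] at this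
    linarith
  have hne : T₁ ≠ T₃ := by
    rintro rfl
    rw [dist_self] at hfar
    linarith
  have ht : IsTransverse P.orth T₁ T₃ := by
    refine ⟨fun horth => ?_, fun h => hne (h13 h), fun h => hne (h31 h)⟩
    have := dist_rho_le_of_orth x horth h12 (P.isTransverse_symm h23)
    linarith
  refine ⟨ht, ?_⟩
  rcases hb.transverse T₁ T₃ ht with h | h
  · exact h
  · exfalso
    have hx3 := dist_rho_le_of_separated (by linarith) h1 (P.isTransverse_symm ht) h
    obtain ⟨p, hp⟩ := exists_partial_realization_singleton (P := P) x T₁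
    have hp2 := hp T₂ (Or.inr h12)
    have hp3 := hp T₃ (Or.inr ht)
    rcases P.consistency_transverse T₂ T₃ h23 p with h4 | h4
    · have k1 := dist_triangle_left (P.rho T₁ T₃) (P.rho T₂ T₃) (P.pt T₃ p)
      have k2 := dist_triangle4 (P.pt T₃ x) (P.rho T₁ T₃) (P.rho T₂ T₃) (b T₃)
      rw [dist_comm (P.rho T₂ T₃) (b T₃)] at k2
      linarith
    · have := dist_triangle_left (P.rho T₁ T₂) (P.rho T₃ T₂) (P.pt T₂ p)
      linarith

/-- Among the coordinates in which `x` is far from `b` there is one at which `b` is pinned. -/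
theorem Consistent.exists_pinned {κ c : ℝ} {b : ∀ W, C W} (hb : P.Consistent κ b)
    (hκ : P.B ≤ κ) (hc : 10 * κ ≤ c) {x : X} (hne : ∃ W, c < dist (P.pt W x) (b W)) :
    ∃ W, c < dist (P.pt W x) (b W) ∧ P.Pinned (2 * c) b W := by
  have hB := P.one_le_B
  set F : Set 𝔖 := {W | c < dist (P.pt W x) (b W)}
  have hfin : F.Finite := (hb.finite x).subset fun W hW => lt_of_le_of_lt hc hW
  set M : Set 𝔖 := {W | Maximal (· ∈ F) W}
  have hMF : M ⊆ F := fun W hW => hW.prop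
  obtain ⟨W₀, hW₀⟩ := hfin.exists_maximal hne
  -- Among the maximal coordinates separating `x` from `b`, `W` is one crossed last.
  obtain ⟨W, hW, hmin⟩ := (hfin.subset hMF).exists_not_rel ⟨W₀, hW₀⟩
    (r := fun T T' => IsTransverse P.orth T T' ∧ dist (b T') (P.rho T T') ≤ κ)
    (fun T _ h => h.1.2.1 le_rfl)
    (fun T₁ h1 T₂ h2 T₃ h3 h12 h23 => hb.rel_trans hκ hc (hMF h1) (hMF h2) (hMF h3)
      (fun h => h.antisymm (h1.2 (hMF h3) h)) (fun h => (h3.2 (hMF h1) h).antisymm h)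
      h12.1 h12.2 h23.1 h23.2)
  have hWF : c < dist (P.pt W x) (b W) := hMF hW
  refine ⟨W, hWF, fun U hU => ?_⟩
  by_contra! hcon
  by_cases hUF : U ∈ F
  · rcases hU with hU | hU
    · exact absurd (hW.2 hUF hU.le) (not_le_of_gt hU)
    -- A maximal `U'` above `U` is crossed before `W`, so `x` is near the trace of `U'` in `C W`,
    -- hence near that of `U`. Consistency puts `b` there too, although `W` separates them.
    · obtain ⟨U', hUU', hU'⟩ := hfin.exists_le_maximal hUF
      have htr : IsTransverse P.orth U' W := by
        refine ⟨fun h => hU.1 (P.orth_symm _ _ (P.orth_of_nested _ _ _ hUU' h)),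
          fun h => hU.2.2 (hUU'.trans h), fun h => ?_⟩
        exact hU.2.2 (hUU'.trans (hW.2 hU'.prop h))
      have h1 : dist (b W) (P.rho U W) ≤ κ := by
        rcases hb.transverse W U hU with h | h
        · linarith
        · exact h
      have h2 := P.rho_close U U' W hUU' htr hU.1
      have h3 : dist (b U') (P.rho W U') ≤ κ := by
        rcases hb.transverse U' W htr with h | h
        · exact absurd ⟨htr, h⟩ (hmin U' hU')
        · exact h
      have h4 := dist_rho_le_of_separated (by linarith) (hMF hU') (P.isTransverse_symm htr) h3
      have := dist_triangle4 (P.pt W x) (P.rho U' W) (P.rho U W) (b W)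
      rw [dist_comm (P.rho U' W), dist_comm (P.rho U W) (b W)] at this
      linarith
  · have hUF : dist (P.pt U x) (b U) ≤ c := not_lt.1 hUF
    -- Now `x` and `b` are close in `C U` and both far from `ρ^W_U`. Consistency and bounded
    -- geodesic image then force them close in `C W`.
    have hxU : c < dist (P.pt U x) (P.rho W U) := by
      have := dist_triangle_left (b U) (P.rho W U) (P.pt U x)
      linarith
    rcases hU with hU | hU
    · have h1 : dist (b W) (P.down U W (b U)) ≤ κ := by
        rcases hb.nested W U hU with h | h
        · linarith
        · exact h
      have h2 : dist (P.pt W x) (P.down U W (P.pt U x)) ≤ P.B := by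
        rcases P.consistency_nested W U hU x with h | h
        · linarith
        · exact h
      rcases P.bounded_geodesic_image W U hU (P.pt U x) (b U) with h | h
      · have := dist_triangle4 (P.pt W x) (P.down U W (P.pt U x)) (P.down U W (b U)) (b W)
        rw [dist_comm (P.down U W (b U)) (b W)] at this
        linarith
      · unfold CoarselyBetween at h
        rw [dist_comm _ (b U)] at h
        linarith
    · have h1 : dist (b W) (P.rho U W) ≤ κ := by
        rcases hb.transverse W U hU with h | h
        · linarith
        · exact h
      have h2 : dist (P.pt W x) (P.rho U W) ≤ P.B := by
        rcases P.consistency_transverse W U hU x with h | h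
        · linarith
        · exact h
      have := dist_triangle_right (P.pt W x) (b W) (P.rho U W)
      linarith

/-- This sum is the potential that each improvement raises, so the number of improvements is
bounded. -/
theorem sum_depth_le (P : PointedHierarchy X 𝔖 C) (s : Finset 𝔖)
    (hs : (s : Set 𝔖).Pairwise P.orth) :
    ∑ V ∈ s, (P.n + 1 - P.ht V) ≤ (P.n + 1) * (P.n + 1) :=
  (Finset.sum_le_card_nsmul s _ (P.n + 1) fun _ _ => Nat.sub_le _ _).trans
    (Nat.mul_le_mul_right _ (P.card_le_of_orth s hs))

/-- A partial realization of `b` either realizes `b` or can be improved. -/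
theorem Consistent.realize_or_improve {κ c : ℝ} {b : ∀ W, C W} (hb : P.Consistent κ b)
    (hκ : P.B ≤ κ) (hc : κ ≤ c) {𝒱 : Finset 𝔖} (h𝒱 : (𝒱 : Set 𝔖).Pairwise P.orth)
    (hpin : ∀ V ∈ 𝒱, P.Pinned c b V) :
    (∃ x, ∀ W, dist (P.pt W x) (b W) ≤ 10 * c) ∨
      ∃ 𝒱' : Finset 𝔖, (𝒱' : Set 𝔖).Pairwise P.orth ∧ (∀ V ∈ 𝒱', P.Pinned (20 * c) b V) ∧
        ∑ V ∈ 𝒱, (P.n + 1 - P.ht V) < ∑ V ∈ 𝒱', (P.n + 1 - P.ht V) := by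
  classical
  have hB := P.one_le_B
  obtain ⟨x, hx⟩ := P.partial_realization 𝒱 h𝒱 b (fun V _ => hb.mem V)
  by_cases hall : ∀ W, dist (P.pt W x) (b W) ≤ 10 * c
  · exact Or.inl ⟨x, hall⟩
  right
  push Not at hall
  -- Applied at scale `10 * c`, which gives pinning with constant `2 * (10 * c)`.
  obtain ⟨W, hW, hWpin⟩ := hb.exists_pinned hκ (by linarith) hall
  have hrel : ∀ V ∈ 𝒱, P.orth V W ∨ W < V := by
    intro V hV
    -- Otherwise both `x` and `b` would be near `ρ^V_W`.
    have hVW : ¬ (V < W ∨ IsTransverse P.orth V W) := fun h => by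
      have h1 := (hx V hV).2 W h
      have h2 := hpin V hV W h
      have := dist_triangle_right (P.pt W x) (b W) (P.rho V W)
      linarith
    have hne : V ≠ W := by
      rintro rfl
      have := (hx V hV).1
      linarith
    by_cases horth : P.orth V W
    · exact Or.inl horth
    · right
      by_contra hlt
      exact hVW (Or.inr ⟨horth, fun h => hVW (Or.inl (lt_of_le_of_ne h hne)),
        fun h => hlt (lt_of_le_of_ne h hne.symm)⟩)
  have hWpin : P.Pinned (20 * c) b W := fun U hU => (hWpin U hU).trans (by linarith)
  have hpin' : ∀ V ∈ 𝒱, P.Pinned (20 * c) b V := fun V hV U hU =>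
    (hpin V hV U hU).trans (by linarith)
  have hWn := P.ht_le W
  have hins : ∀ s : Finset 𝔖, s ⊆ 𝒱 → (∀ V ∈ s, P.orth V W) →
      ((insert W s : Finset 𝔖) : Set 𝔖).Pairwise P.orth ∧
      ∀ V ∈ insert W s, P.Pinned (20 * c) b V := by
    intro s hs horth
    constructor
    · rw [Finset.coe_insert]
      exact (h𝒱.mono (Finset.coe_subset.2 hs)).insert fun V hV _ =>
        ⟨P.orth_symm _ _ (horth V hV), horth V hV⟩
    · intro V hV
      rcases Finset.mem_insert.1 hV with rfl | hV
      · exact hWpin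
      · exact hpin' V (hs hV)
  have hnotmem : ∀ s : Finset 𝔖, (∀ V ∈ s, P.orth V W) → W ∉ s := fun s hs hWs =>
    (P.orth_not_comparable W W (hs W hWs)).1 le_rfl
  by_cases hex : ∃ V ∈ 𝒱, W < V
  -- Replace `V` by the deeper `W`. The remaining elements are orthogonal to `V`, hence to `W`, so
  -- no second element contains `W`.
  · obtain ⟨V, hV, hWV⟩ := hex
    have horth : ∀ V' ∈ 𝒱.erase V, P.orth V' W := fun V' hV' => by
      have hne := Finset.ne_of_mem_erase hV'
      exact P.orth_symm _ _ (P.orth_of_nested _ _ _ hWV.le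
        (h𝒱 hV (Finset.mem_of_mem_erase hV') hne.symm))
    refine ⟨insert W (𝒱.erase V), (hins _ (Finset.erase_subset _ _) horth).1,
      (hins _ (Finset.erase_subset _ _) horth).2, ?_⟩
    rw [Finset.sum_insert (hnotmem _ horth), ← Finset.add_sum_erase _ _ hV]
    have h1 := P.ht_strictMono hWV
    have h2 := P.ht_le V
    omega
  · have horth : ∀ V ∈ 𝒱, P.orth V W := fun V hV =>
      (hrel V hV).resolve_right fun h => hex ⟨V, hV, h⟩
    refine ⟨insert W 𝒱, (hins _ subset_rfl horth).1, (hins _ subset_rfl horth).2, ?_⟩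
    rw [Finset.sum_insert (hnotmem _ horth)]
    omega

/-- Consistent tuples are realized by points. -/
theorem exists_realization (P : PointedHierarchy X 𝔖 C) {κ : ℝ} (hκ : P.B ≤ κ) :
    ∃ θ : ℝ, 0 ≤ θ ∧ ∀ b : ∀ W, C W, P.Consistent κ b →
      ∃ x, ∀ W, dist (P.pt W x) (b W) ≤ θ := by
  have hB := P.one_le_B
  -- `j` bounds the room left for the potential; each improvement multiplies `c` by 20.
  have key : ∀ (j : ℕ) (c : ℝ), κ ≤ c → ∃ θ : ℝ, 0 ≤ θ ∧ ∀ b : ∀ W, C W, P.Consistent κ b →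
      ∀ 𝒱 : Finset 𝔖, (𝒱 : Set 𝔖).Pairwise P.orth → (∀ V ∈ 𝒱, P.Pinned c b V) →
        (P.n + 1) * (P.n + 1) ≤ ∑ V ∈ 𝒱, (P.n + 1 - P.ht V) + j →
          ∃ x, ∀ W, dist (P.pt W x) (b W) ≤ θ := by
    intro j
    induction j with
    | zero =>
      intro c hc
      refine ⟨10 * c, by linarith, fun b hb 𝒱 h𝒱 hpin hj => ?_⟩
      rcases hb.realize_or_improve hκ hc h𝒱 hpin with h | ⟨𝒱', h1, -, h3⟩
      · exact h
      · have := P.sum_depth_le 𝒱' h1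
        omega
    | succ j ih =>
      intro c hc
      obtain ⟨θ, hθ, h⟩ := ih (20 * c) (by linarith)
      refine ⟨max (10 * c) θ, le_max_of_le_right hθ, fun b hb 𝒱 h𝒱 hpin hj => ?_⟩
      rcases hb.realize_or_improve hκ hc h𝒱 hpin with ⟨x, hx⟩ | ⟨𝒱', h1, h2, h3⟩
      · exact ⟨x, fun W => (hx W).trans (le_max_left _ _)⟩
      · obtain ⟨x, hx⟩ := h b hb 𝒱' h1 h2 (by omega)
        exact ⟨x, fun W => (hx W).trans (le_max_right _ _)⟩
  obtain ⟨θ, hθ, h⟩ := key ((P.n + 1) * (P.n + 1)) κ le_rfl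
  exact ⟨θ, hθ, fun b hb => h b hb ∅ (by simp) (by simp) (by simp)⟩

end PointedHierarchy

/-! ### Coarse medians in `X`. -/

theorem two_of_three {a b c a' b' c' : Prop} (ha : a ∨ a') (hb : b ∨ b') (hc : c ∨ c') :
    ((a ∧ b) ∨ (a ∧ c) ∨ (b ∧ c)) ∨ ((a' ∧ b') ∨ (a' ∧ c') ∨ (b' ∧ c')) := by
  tauto

section CoarselyBetween

variable {M : Type*} [MetricSpace M] {c e : ℝ} {p q m r : M}

theorem CoarselyBetween.two_mul_dist_le (h : CoarselyBetween c p m q) (hp : dist p r ≤ e)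
    (hq : dist q r ≤ e) : 2 * dist m r ≤ 4 * e + c := by
  unfold CoarselyBetween at h
  have h1 := dist_triangle_left m r p
  have h2 := dist_triangle m q r
  have h3 := dist_triangle_right p q r
  linarith

theorem CoarselyBetween.two_mul_dist_le_of_branch (h : CoarselyBetween c p m q)
    (hp : CoarselyBetween e m r p) (hq : CoarselyBetween e m r q) :
    2 * dist m r ≤ 2 * e + c := by
  unfold CoarselyBetween at *
  have := dist_triangle_left p q r
  rw [dist_comm m p] at hp
  linarith

end CoarselyBetween

namespace PointedHierarchy

variable {X : Type*} [MetricSpace X] {𝔖 : Type*} [PartialOrder 𝔖] {C : 𝔖 → Type*}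
  [∀ W, MetricSpace (C W)] {P : PointedHierarchy X 𝔖 C}

/-- Majority vote: of two alternatives, one holds for two of `x`, `y`, `z`, and the median lies
between those two. For nested pairs, bounded geodesic image is applied from the median to each of
the three points. If `ρ^V_W` separates it from two of them, it must be near `ρ^V_W`. -/
theorem consistent_median {x y z : X} {b : ∀ W, C W} (hmem : ∀ W, b W ∈ P.image W)
    (hxy : ∀ W, CoarselyBetween P.B (P.pt W x) (b W) (P.pt W y))
    (hxz : ∀ W, CoarselyBetween P.B (P.pt W x) (b W) (P.pt W z))
    (hyz : ∀ W, CoarselyBetween P.B (P.pt W y) (b W) (P.pt W z)) :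
    P.Consistent (10 * P.B) b := by
  have hB := P.one_le_B
  have maj : ∀ (W : 𝔖) (r : C W) (e : ℝ), (dist (P.pt W x) r ≤ e ∧ dist (P.pt W y) r ≤ e) ∨
      (dist (P.pt W x) r ≤ e ∧ dist (P.pt W z) r ≤ e) ∨
      (dist (P.pt W y) r ≤ e ∧ dist (P.pt W z) r ≤ e) → 2 * dist (b W) r ≤ 4 * e + P.B := by
    rintro W r e (⟨h1, h2⟩ | ⟨h1, h2⟩ | ⟨h1, h2⟩)
    · exact (hxy W).two_mul_dist_le h1 h2
    · exact (hxz W).two_mul_dist_le h1 h2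
    · exact (hyz W).two_mul_dist_le h1 h2
  refine ⟨hmem, fun V W h => ?_, fun V W h => ?_, fun w => ?_⟩
  · rcases two_of_three (P.consistency_transverse V W h x) (P.consistency_transverse V W h y)
      (P.consistency_transverse V W h z) with h1 | h1
    · left
      have := maj W (P.rho V W) P.B h1
      linarith
    · right
      have := maj V (P.rho W V) P.B h1
      linarith
  · have hbr : ∀ w, dist (P.pt V w) (P.down W V (b W)) ≤ 2 * P.B ∨
        CoarselyBetween (3 * P.B) (b W) (P.rho V W) (P.pt W w) := by
      intro w
      rcases P.bounded_geodesic_image V W h (b W) (P.pt W w) with h2 | h2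
      · rcases P.consistency_nested V W h w with h3 | h3
        · right
          unfold CoarselyBetween
          have := dist_triangle_right (b W) (P.rho V W) (P.pt W w)
          rw [dist_comm (P.rho V W)] at *
          linarith
        · left
          have := dist_triangle_right (P.pt V w) (P.down W V (b W)) (P.down W V (P.pt W w))
          linarith
      · right
        exact h2.mono (by linarith)
    rcases two_of_three (hbr x) (hbr y) (hbr z) with h1 | h1
    · right
      have := maj V (P.down W V (b W)) (2 * P.B) h1
      linarith
    · left
      rcases h1 with h1 | h1 | h1
      · have := (hxy W).two_mul_dist_le_of_branch h1.1 h1.2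
        linarith
      · have := (hxz W).two_mul_dist_le_of_branch h1.1 h1.2
        linarith
      · have := (hyz W).two_mul_dist_le_of_branch h1.1 h1.2
        linarith
  · refine ((P.finite_relevant w x).union (P.finite_relevant w y)).subset fun W hW => ?_
    by_contra hcon
    simp only [Set.mem_union, Set.mem_ofPred_eq, not_or, not_le] at hcon
    have := maj W (P.pt W w) P.B (Or.inl ⟨by rw [dist_comm]; exact hcon.1.le,
      by rw [dist_comm]; exact hcon.2.le⟩)
    have hW : 10 * (10 * P.B) < dist (P.pt W w) (b W) := hW
    rw [dist_comm] at hW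
    linarith

/-- Coarse medians exist in `X`. -/
theorem exists_median (P : PointedHierarchy X 𝔖 C) : ∃ M : ℝ, P.B ≤ M ∧ ∀ x y z : X, ∃ m : X,
    ∀ W, CoarselyBetween M (P.pt W x) (P.pt W m) (P.pt W y) ∧
      CoarselyBetween M (P.pt W x) (P.pt W m) (P.pt W z) ∧
      CoarselyBetween M (P.pt W y) (P.pt W m) (P.pt W z) := by
  have hB := P.one_le_B
  obtain ⟨θ, hθ, h⟩ := P.exists_realization (κ := 10 * P.B) (by linarith)
  refine ⟨P.B + 2 * θ, by linarith, fun x y z => ?_⟩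
  choose b hmem h1 h2 h3 using fun W => P.median W x y z
  obtain ⟨m, hm⟩ := h b (consistent_median hmem h1 h2 h3)
  refine ⟨m, fun W => ?_⟩
  have hm' : dist (b W) (P.pt W m) ≤ θ := by
    rw [dist_comm]
    exact hm W
  exact ⟨(h1 W).of_dist_le hm', (h2 W).of_dist_le hm', (h3 W).of_dist_le hm'⟩

end PointedHierarchy

/-! ### Truncated positions on an interval. -/

section Truncate

/-- The position `τ` on an interval of length `ℓ`, with the ends of length `D` collapsed. -/
noncomputable def truncate (D ℓ τ : ℝ) : ℝ := max 0 (min (τ - D) (ℓ - 2 * D))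

variable {D ℓ : ℝ}

theorem truncate_nonneg (τ : ℝ) : 0 ≤ truncate D ℓ τ := le_max_left _ _

theorem truncate_le (h : 2 * D ≤ ℓ) (τ : ℝ) : truncate D ℓ τ ≤ ℓ - 2 * D :=
  max_le (by linarith) (min_le_right _ _)

theorem truncate_zero (hD : 0 ≤ D) : truncate D ℓ 0 = 0 :=
  max_eq_left ((min_le_left _ _).trans (by linarith))

theorem truncate_self (hD : 0 ≤ D) (h : 2 * D ≤ ℓ) : truncate D ℓ ℓ = ℓ - 2 * D := by
  rw [truncate, min_eq_right (by linarith), max_eq_right (by linarith)]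

theorem lt_of_truncate_pos {τ : ℝ} (h : 0 < truncate D ℓ τ) : D < τ := by
  rcases lt_max_iff.1 h with h | h
  · exact absurd h (lt_irrefl _)
  · linarith [(lt_min_iff.1 h).1]

theorem lt_of_truncate_lt {τ : ℝ} (h : truncate D ℓ τ < ℓ - 2 * D) : τ < ℓ - D := by
  rcases min_lt_iff.1 ((le_max_right _ _).trans_lt h) with h | h
  · linarith
  · exact absurd h (lt_irrefl _)

theorem truncate_mono {a b : ℝ} (h : a ≤ b) : truncate D ℓ a ≤ truncate D ℓ b :=
  max_le_max le_rfl (min_le_min (by linarith) le_rfl)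

theorem truncate_add_le {c : ℝ} (hc : 0 ≤ c) (a : ℝ) :
    truncate D ℓ (a + c) ≤ truncate D ℓ a + c := by
  unfold truncate
  refine max_le (by linarith [le_max_left 0 (min (a - D) (ℓ - 2 * D))]) ?_
  have := le_max_right 0 (min (a - D) (ℓ - 2 * D))
  rcases min_choice (a - D) (ℓ - 2 * D) with h | h
  · linarith [min_le_left (a + c - D) (ℓ - 2 * D)]
  · linarith [min_le_right (a + c - D) (ℓ - 2 * D)]

theorem abs_truncate_sub_le (a b : ℝ) : |truncate D ℓ a - truncate D ℓ b| ≤ |a - b| := by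
  rcases le_total a b with h | h
  · have h1 := truncate_mono (D := D) (ℓ := ℓ) h
    have h2 := truncate_add_le (D := D) (ℓ := ℓ) (sub_nonneg.2 h) a
    rw [add_sub_cancel] at h2
    rw [abs_of_nonpos (by linarith), abs_of_nonpos (by linarith)]
    linarith
  · have h1 := truncate_mono (D := D) (ℓ := ℓ) h
    have h2 := truncate_add_le (D := D) (ℓ := ℓ) (sub_nonneg.2 h) b
    rw [add_sub_cancel] at h2
    rw [abs_of_nonneg (by linarith), abs_of_nonneg (by linarith)]
    linarith

/-- Only the end pieces `[0, D]` and `[ℓ - D, ℓ + M]` are collapsed, of total length `2 * D + M`. -/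
theorem abs_sub_le_abs_truncate {M a b : ℝ} (hD : 0 ≤ D) (hM : 0 ≤ M)
    (ha : 0 ≤ a) (hb : 0 ≤ b) (haM : a ≤ ℓ + M) (hbM : b ≤ ℓ + M) :
    |a - b| ≤ |truncate D ℓ a - truncate D ℓ b| + 2 * D + M := by
  wlog hab : a ≤ b generalizing a b
  · rw [abs_sub_comm a b, abs_sub_comm (truncate D ℓ a)]
    exact this hb ha hbM haM (le_of_not_ge hab)
  rw [abs_of_nonpos (by linarith : a - b ≤ 0),
    abs_of_nonpos (by linarith [truncate_mono (D := D) (ℓ := ℓ) hab])]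
  unfold truncate
  have h1 := le_max_left 0 (min (b - D) (ℓ - 2 * D))
  have h2 := le_max_right 0 (min (b - D) (ℓ - 2 * D))
  rcases max_cases 0 (min (a - D) (ℓ - 2 * D)) with h3 | h3 <;>
  rcases min_cases (a - D) (ℓ - 2 * D) with h4 | h4 <;>
  rcases min_cases (b - D) (ℓ - 2 * D) with h5 | h5 <;> linarith

/-- The order of the positions fails by at most `c`, and truncation preserves this. If all values
are extreme and the extremes differ by more than `c`, the order cannot fail at all, so the error
disappears. -/
theorem truncate_between {a b z c : ℝ} (hc : 0 ≤ c) (h : |a - z| + |z - b| ≤ |a - b| + c) :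
    |truncate D ℓ a - truncate D ℓ z| + |truncate D ℓ z - truncate D ℓ b| ≤
      |truncate D ℓ a - truncate D ℓ b| + 2 * c ∧
    (c < ℓ - 2 * D → (∀ t ∈ ({a, b, z} : Set ℝ), truncate D ℓ t = 0 ∨
        truncate D ℓ t = ℓ - 2 * D) →
      |truncate D ℓ a - truncate D ℓ z| + |truncate D ℓ z - truncate D ℓ b| ≤
        |truncate D ℓ a - truncate D ℓ b|) := by
  wlog hab : a ≤ b generalizing a b
  · have h' : |b - z| + |z - a| ≤ |b - a| + c := by
      rw [abs_sub_comm b z, abs_sub_comm z a, abs_sub_comm b a]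
      linarith
    obtain ⟨h1, h2⟩ := this h' (le_of_not_ge hab)
    have e1 := abs_sub_comm (truncate D ℓ b) (truncate D ℓ z)
    have e2 := abs_sub_comm (truncate D ℓ z) (truncate D ℓ a)
    have e3 := abs_sub_comm (truncate D ℓ b) (truncate D ℓ a)
    refine ⟨by linarith, fun h3 h4 => ?_⟩
    have := h2 h3 (by rw [Set.insert_comm]; exact h4)
    linarith
  have h1 : a ≤ z + c := by
    rw [abs_of_nonpos (by linarith : a - b ≤ 0)] at h
    have := le_abs_self (a - z)
    have := neg_le_abs (z - b)
    linarith
  have h2 : z ≤ b + c := by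
    rw [abs_of_nonpos (by linarith : a - b ≤ 0)] at h
    have := neg_le_abs (a - z)
    have := le_abs_self (z - b)
    linarith
  have t1 := (truncate_mono (D := D) (ℓ := ℓ) h1).trans (truncate_add_le hc z)
  have t2 := (truncate_mono (D := D) (ℓ := ℓ) h2).trans (truncate_add_le hc b)
  have t3 := truncate_mono (D := D) (ℓ := ℓ) hab
  refine ⟨?_, fun h3 h4 => ?_⟩
  · rw [abs_of_nonpos (by linarith : truncate D ℓ a - truncate D ℓ b ≤ 0)]
    rcases abs_cases (truncate D ℓ a - truncate D ℓ z) with h5 | h5 <;>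
    rcases abs_cases (truncate D ℓ z - truncate D ℓ b) with h6 | h6 <;> linarith
  · rw [abs_of_nonpos (by linarith : truncate D ℓ a - truncate D ℓ b ≤ 0)]
    have ha := h4 a (by simp)
    have hb := h4 b (by simp)
    have hz := h4 z (by simp)
    have k1 : truncate D ℓ a ≤ truncate D ℓ z := by
      rcases ha with ha | ha <;> rcases hz with hz | hz <;> linarith
    have k2 : truncate D ℓ z ≤ truncate D ℓ b := by
      rcases hb with hb | hb <;> rcases hz with hz | hz <;> linarith
    rw [abs_of_nonpos (by linarith), abs_of_nonpos (by linarith)]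
    linarith

end Truncate

/-! ### Active coordinates, and the bound of the sum by the distance. -/

namespace PointedHierarchy

variable {X : Type*} [MetricSpace X] {𝔖 : Type*} [PartialOrder 𝔖] {C : 𝔖 → Type*}
  [∀ W, MetricSpace (C W)] (P : PointedHierarchy X 𝔖 C)

/-- The truncated position of `u` on the way from `x` to `y`, seen in `C T`. -/
noncomputable def coord (x y : X) (D : ℝ) (T : 𝔖) (u : X) : ℝ :=
  truncate D (dist (P.pt T x) (P.pt T y)) (dist (P.pt T x) (P.pt T u))

/-- Seen in `C T`, the point `u` is far from `x` and from `y`. -/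
def Active (x y : X) (D : ℝ) (T : 𝔖) (u : X) : Prop :=
  0 < P.coord x y D T u ∧ P.coord x y D T u < dist (P.pt T x) (P.pt T y) - 2 * D

/-- The `ℓ¹` distance of the truncated positions in the coordinates from `R`. -/
noncomputable def gap (x y : X) (D : ℝ) (R : Finset 𝔖) (u v : X) : ℝ :=
  ∑ T ∈ R, |P.coord x y D T u - P.coord x y D T v|

variable {P} {x y : X} {D : ℝ} {R : Finset 𝔖}

theorem eq_zero_or_eq_of_not_active {T : 𝔖} {u : X}
    (h : 2 * D ≤ dist (P.pt T x) (P.pt T y)) (hu : ¬ P.Active x y D T u) :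
    P.coord x y D T u = 0 ∨ P.coord x y D T u = dist (P.pt T x) (P.pt T y) - 2 * D := by
  have h1 : 0 ≤ P.coord x y D T u := truncate_nonneg _
  have h2 : P.coord x y D T u ≤ _ := truncate_le h _
  by_contra! hcon
  exact hu ⟨lt_of_le_of_ne h1 hcon.1.symm, lt_of_le_of_ne h2 hcon.2⟩

theorem Active.lt_dist {T : 𝔖} {u : X} (h : P.Active x y D T u) :
    D < dist (P.pt T x) (P.pt T u) ∧ D < dist (P.pt T y) (P.pt T u) := by
  have h1 := lt_of_truncate_pos h.1
  have h2 := lt_of_truncate_lt h.2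
  have := dist_triangle_right (P.pt T x) (P.pt T y) (P.pt T u)
  exact ⟨h1, by linarith⟩

/-- If `u` is near the trace of `T` in `C T'`, then `x` and `y` are far from it, so both are near
the trace of `T'` in `C T`. This contradicts their distance exceeding `2 * D` there. -/
theorem Active.not_transverse (hD : 3 * P.B ≤ D) {T T' : 𝔖} {u : X}
    (hT : P.Active x y D T u) (hT' : P.Active x y D T' u) : ¬ IsTransverse P.orth T T' := by
  have hB := P.one_le_B
  have key : ∀ T T', P.Active x y D T u → P.Active x y D T' u → IsTransverse P.orth T T' →
      ¬ dist (P.pt T' u) (P.rho T T') ≤ P.B := by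
    intro T T' hT hT' h hu
    have h1 := hT'.lt_dist
    have far : ∀ w, D < dist (P.pt T' w) (P.pt T' u) → dist (P.pt T w) (P.rho T' T) ≤ P.B := by
      intro w hw
      rcases P.consistency_transverse T T' h w with h2 | h2
      · have := dist_triangle_right (P.pt T' w) (P.pt T' u) (P.rho T T')
        linarith
      · exact h2
    have h2 := dist_triangle_right (P.pt T x) (P.pt T y) (P.rho T' T)
    have h3 := far x h1.1
    have h4 := far y h1.2
    have h5 := hT.1.trans hT.2
    linarith
  intro h
  rcases P.consistency_transverse T T' h u with h1 | h1
  · exact key T T' hT hT' h h1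
  · exact key T' T hT' hT (P.isTransverse_symm h) h1

/-- At most boundedly many coordinates are active at a given point. -/
theorem sum_le_of_not_active (hD : 3 * P.B ≤ D) (S : Finset X) {f : 𝔖 → ℝ} {J : ℝ}
    (hJ : 0 ≤ J) (h1 : ∀ T ∈ R, f T ≤ J)
    (h2 : ∀ T ∈ R, (∀ u ∈ S, ¬ P.Active x y D T u) → f T ≤ 0) :
    ∑ T ∈ R, f T ≤ S.card * ((P.n + 1) * (P.n + 1)) * J := by
  classical
  set A : Finset 𝔖 := S.biUnion fun u => R.filter fun T => P.Active x y D T u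
  have hcard : A.card ≤ S.card * ((P.n + 1) * (P.n + 1)) := by
    refine Finset.card_biUnion_le_card_mul _ _ _ fun u _ => ?_
    refine P.card_le_of_not_transverse _ fun V hV W hW => ?_
    exact (Finset.mem_filter.1 hV).2.not_transverse hD (Finset.mem_filter.1 hW).2
  calc ∑ T ∈ R, f T ≤ ∑ T ∈ R, if T ∈ A then J else 0 := by
        refine Finset.sum_le_sum fun T hT => ?_
        split_ifs with h
        · exact h1 T hT
        · refine h2 T hT fun u hu hact => h ?_
          exact Finset.mem_biUnion.2 ⟨u, hu, Finset.mem_filter.2 ⟨hT, hact⟩⟩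
    _ = ((R.filter fun T => T ∈ A).card : ℝ) * J := by
        rw [← Finset.sum_filter, Finset.sum_const, nsmul_eq_mul]
    _ ≤ (A.card : ℝ) * J := by
        refine mul_le_mul_of_nonneg_right ?_ hJ
        exact_mod_cast Finset.card_le_card fun T hT => (Finset.mem_filter.1 hT).2
    _ ≤ S.card * ((P.n + 1) * (P.n + 1)) * J := by
        refine mul_le_mul_of_nonneg_right ?_ hJ
        exact_mod_cast hcard

theorem gap_triangle (u v w : X) :
    P.gap x y D R u w ≤ P.gap x y D R u v + P.gap x y D R v w := by
  unfold gap
  rw [← Finset.sum_add_distrib]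
  exact Finset.sum_le_sum fun T _ => abs_sub_le _ _ _

theorem gap_endpoints (hD : 0 ≤ D) (hR : ∀ T ∈ R, 2 * D ≤ dist (P.pt T x) (P.pt T y)) :
    P.gap x y D R x y = ∑ T ∈ R, (dist (P.pt T x) (P.pt T y) - 2 * D) := by
  refine Finset.sum_congr rfl fun T hT => ?_
  have h := hR T hT
  rw [coord, coord, dist_self, truncate_zero hD, truncate_self hD h, zero_sub, abs_neg,
    abs_of_nonneg (by linarith)]

theorem abs_coord_sub_le (T : 𝔖) (u v : X) :
    |P.coord x y D T u - P.coord x y D T v| ≤ dist (P.pt T u) (P.pt T v) := by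
  refine (abs_truncate_sub_le _ _).trans ?_
  rw [dist_comm (P.pt T x), dist_comm (P.pt T x)]
  exact abs_dist_sub_le _ _ _

/-- A coordinate active at neither point cannot jump between the extremes, since these are more than
`J` apart. Only boundedly many coordinates change. -/
theorem gap_le_of_step (hD : 3 * P.B ≤ D) {J : ℝ} (hJ : 0 ≤ J) {u v : X}
    (hR : ∀ T ∈ R, 2 * D + J < dist (P.pt T x) (P.pt T y))
    (huv : ∀ T, dist (P.pt T u) (P.pt T v) ≤ J) :
    P.gap x y D R u v ≤ 2 * ((P.n + 1) * (P.n + 1)) * J := by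
  classical
  have hb : ∀ T, |P.coord x y D T u - P.coord x y D T v| ≤ J := fun T =>
    (abs_coord_sub_le T u v).trans (huv T)
  refine (sum_le_of_not_active (x := x) (y := y) hD {u, v} hJ (fun T _ => hb T) fun T hT h => ?_).trans ?_
  · have hl := hR T hT
    have hu := eq_zero_or_eq_of_not_active (by linarith) (h u (by simp))
    have hv := eq_zero_or_eq_of_not_active (by linarith) (h v (by simp))
    have h1 := abs_le.1 (hb T)
    have : P.coord x y D T u - P.coord x y D T v = 0 := by
      rcases hu with hu | hu <;> rcases hv with hv | hv <;> rw [hu, hv] at h1 ⊢ <;> linarith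
    rw [this, abs_zero]
  · have : (({u, v} : Finset X).card : ℝ) ≤ 2 := by exact_mod_cast Finset.card_le_two
    gcongr

/-- The sum of the relevant projection distances is coarsely bounded by the distance. -/
theorem sum_le_dist (hD : 3 * P.B ≤ D)
    (hR : ∀ T ∈ R, 4 * D + (P.B * P.B + P.B) < dist (P.pt T x) (P.pt T y)) :
    ∑ T ∈ R, dist (P.pt T x) (P.pt T y) ≤
      2 * (2 * ((P.n + 1) * (P.n + 1)) * (P.B * P.B + P.B)) * (P.B * dist x y + P.B) := by
  have hB := P.one_le_B
  have hJ : 0 ≤ P.B * P.B + P.B := by positivity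
  obtain ⟨N, z, hN, h0, hNy, hz⟩ := P.exists_path x y
  set L : ℝ := 2 * ((P.n + 1) * (P.n + 1)) * (P.B * P.B + P.B) with hL
  have hL0 : 0 ≤ L := by positivity
  have hpath : ∀ k ≤ N, P.gap x y D R (z 0) (z k) ≤ k * L := by
    intro k
    induction k with
    | zero => simp [gap]
    | succ k ih =>
      intro hk
      have h1 := ih (by omega)
      have h2 : P.gap x y D R (z k) (z (k + 1)) ≤ L := by
        refine gap_le_of_step hD hJ (fun T hT => by linarith [hR T hT]) fun T => ?_
        refine (P.lipschitz T _ _).trans ?_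
        gcongr
        exact hz k (by omega)
      have h3 := gap_triangle (P := P) (x := x) (y := y) (D := D) (R := R) (z 0) (z k) (z (k + 1))
      push_cast
      linarith
  have h1 := hpath N le_rfl
  rw [h0, hNy, gap_endpoints (by linarith) fun T hT => by linarith [hR T hT]] at h1
  -- Each relevant distance exceeds `4 * D`, so truncation costs at most half of it.
  have h2 : ∑ T ∈ R, dist (P.pt T x) (P.pt T y) ≤
      2 * ∑ T ∈ R, (dist (P.pt T x) (P.pt T y) - 2 * D) := by
    rw [Finset.mul_sum]
    exact Finset.sum_le_sum fun T hT => by linarith [hR T hT]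
  have h3 : (N : ℝ) * L ≤ (P.B * dist x y + P.B) * L := mul_le_mul_of_nonneg_right hN hL0
  linarith

/-! ### The hull, and the bound of the distance by the sum. -/

/-- The points which lie coarsely between `x` and `y` in all coordinates. -/
def InHull (P : PointedHierarchy X 𝔖 C) (M : ℝ) (x y u : X) : Prop :=
  ∀ T, CoarselyBetween M (P.pt T x) (P.pt T u) (P.pt T y)

theorem coarselyBetween_of_between {M : ℝ} (hM : P.B ≤ M) {T : 𝔖} {a b u v q : C T}
    (hu : CoarselyBetween M a u b) (hv : CoarselyBetween M a v b)
    (hq : CoarselyBetween M u q v) : CoarselyBetween (5 * M) a q b := by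
  wlog h : dist a u ≤ dist a v generalizing u v
  · exact this hv hu hq.symm (le_of_not_ge h)
  have h1 := P.dist_le_abs_sub T M a b u v hu hv
  rw [abs_of_nonpos (by linarith)] at h1
  unfold CoarselyBetween at *
  have := dist_triangle a u q
  have := dist_triangle q v b
  linarith

/-- Between two points of the hull which are far apart in some coordinate there is a point of
the hull which makes definite progress. -/
theorem InHull.exists_between {M : ℝ} (hM : P.B ≤ M)
    (hmed : ∀ x y z : X, ∃ m : X, ∀ W, CoarselyBetween M (P.pt W x) (P.pt W m) (P.pt W y) ∧
      CoarselyBetween M (P.pt W x) (P.pt W m) (P.pt W z) ∧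
      CoarselyBetween M (P.pt W y) (P.pt W m) (P.pt W z))
    {u v : X} (hu : P.InHull M x y u) (hv : P.InHull M x y v) (V : 𝔖) :
    ∃ z, P.InHull M x y z ∧
      (∀ T, CoarselyBetween (9 * M) (P.pt T u) (P.pt T z) (P.pt T v)) ∧
      dist (P.pt V u) (P.pt V v) / 2 - 7 * M ≤ dist (P.pt V u) (P.pt V z) ∧
      dist (P.pt V u) (P.pt V v) / 2 - 7 * M ≤ dist (P.pt V z) (P.pt V v) := by
  -- `p` is only correct in `C V`. The median `q` with `u`, `v` brings it between them everywhere,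
  -- and the median with `x`, `y` restores the constant `M` of the hull. Neither moves it far in `C
  -- V`.
  obtain ⟨p, hp1, hp2⟩ := P.midpoint V u v
  obtain ⟨q, hq⟩ := hmed u v p
  obtain ⟨z, hz⟩ := hmed x y q
  have hqz : ∀ T, dist (P.pt T q) (P.pt T z) ≤ 4 * M := fun T => by
    have h1 := coarselyBetween_of_between hM (hu T) (hv T) (hq T).1
    have h2 := h1.dist_le_of_median (hz T).2.1 (hz T).2.2
    have := P.one_le_B
    linarith
  have hpq : dist (P.pt V p) (P.pt V q) ≤ 2 * M := by
    have h1 : CoarselyBetween (2 * P.B) (P.pt V u) (P.pt V p) (P.pt V v) := by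
      unfold CoarselyBetween
      linarith
    have h2 := h1.dist_le_of_median (hq V).2.1 (hq V).2.2
    linarith
  have hpz := dist_triangle (P.pt V p) (P.pt V q) (P.pt V z)
  have hqzV := hqz V
  refine ⟨z, fun T => (hz T).1, fun T => ((hq T).1.of_dist_le (hqz T)).mono (by linarith), ?_, ?_⟩
  · have h1 := dist_triangle (P.pt V u) (P.pt V p) (P.pt V v)
    have h2 := dist_triangle_right (P.pt V u) (P.pt V p) (P.pt V z)
    linarith
  · have h1 := dist_triangle (P.pt V u) (P.pt V p) (P.pt V v)
    have h2 := dist_triangle (P.pt V p) (P.pt V z) (P.pt V v)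
    linarith

theorem InHull.abs_sub_add_abs_sub_le {M : ℝ} (hM : P.B ≤ M) {u v z : X}
    (hu : P.InHull M x y u) (hv : P.InHull M x y v) {T : 𝔖}
    (hz : CoarselyBetween (9 * M) (P.pt T u) (P.pt T z) (P.pt T v)) :
    |dist (P.pt T x) (P.pt T u) - dist (P.pt T x) (P.pt T z)| +
        |dist (P.pt T x) (P.pt T z) - dist (P.pt T x) (P.pt T v)| ≤
      |dist (P.pt T x) (P.pt T u) - dist (P.pt T x) (P.pt T v)| + 12 * M := by
  have h1 := P.dist_le_abs_sub T M _ _ _ _ (hu T) (hv T)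
  have h2 := abs_dist_sub_le (P.pt T u) (P.pt T z) (P.pt T x)
  have h3 := abs_dist_sub_le (P.pt T z) (P.pt T v) (P.pt T x)
  rw [dist_comm _ (P.pt T x), dist_comm _ (P.pt T x)] at h2 h3
  unfold CoarselyBetween at hz
  linarith

/-- Without truncation every coordinate could contribute an error. Now only those active at `u`, `v`
or `z` do, each at most twice `12 * M`. -/
theorem InHull.gap_add_gap_le (hD : 3 * P.B ≤ D) {M : ℝ} (hM : P.B ≤ M)
    (hR : ∀ T ∈ R, 2 * D + 12 * M < dist (P.pt T x) (P.pt T y)) {u v z : X}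
    (hu : P.InHull M x y u) (hv : P.InHull M x y v)
    (hz : ∀ T, CoarselyBetween (9 * M) (P.pt T u) (P.pt T z) (P.pt T v)) :
    P.gap x y D R u z + P.gap x y D R z v ≤ P.gap x y D R u v +
      3 * ((P.n + 1) * (P.n + 1)) * (24 * M) := by
  classical
  have hB := P.one_le_B
  have h := sum_le_of_not_active (P := P) (x := x) (y := y) (R := R) hD {u, v, z}
    (f := fun T => |P.coord x y D T u - P.coord x y D T z| +
      |P.coord x y D T z - P.coord x y D T v| - |P.coord x y D T u - P.coord x y D T v|)
    (J := 24 * M) (by linarith) ?_ ?_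
  · rw [Finset.sum_sub_distrib, Finset.sum_add_distrib] at h
    have h3 : ((({u, v, z} : Finset X).card : ℝ)) * ((P.n + 1) * (P.n + 1)) * (24 * M) ≤
        3 * ((P.n + 1) * (P.n + 1)) * (24 * M) := by
      have : (({u, v, z} : Finset X).card : ℝ) ≤ 3 := by exact_mod_cast Finset.card_le_three
      gcongr
      linarith
    unfold gap
    linarith
  · intro T _
    have := (truncate_between (D := D) (ℓ := dist (P.pt T x) (P.pt T y)) (by linarith)
      (hu.abs_sub_add_abs_sub_le hM hv (hz T))).1
    simp only [coord]
    linarith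
  · intro T hT hact
    have hl := hR T hT
    have := (truncate_between (D := D) (ℓ := dist (P.pt T x) (P.pt T y)) (by linarith)
      (hu.abs_sub_add_abs_sub_le hM hv (hz T))).2 (by linarith) ?_
    · simp only [coord]
      linarith
    · rintro t (rfl | rfl | rfl)
      · exact eq_zero_or_eq_of_not_active (by linarith) (hact u (by simp))
      · exact eq_zero_or_eq_of_not_active (by linarith) (hact v (by simp))
      · exact eq_zero_or_eq_of_not_active (by linarith) (hact z (by simp))

theorem InHull.dist_le_gap (hD : 0 ≤ D) {M : ℝ} (hM : P.B ≤ M) {u v : X}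
    (hu : P.InHull M x y u) (hv : P.InHull M x y v) {V : 𝔖} (hV : V ∈ R) :
    dist (P.pt V u) (P.pt V v) ≤ P.gap x y D R u v + 2 * D + 4 * M := by
  have hB := P.one_le_B
  have h1 := P.dist_le_abs_sub V M _ _ _ _ (hu V) (hv V)
  have hle : ∀ w, P.InHull M x y w →
      dist (P.pt V x) (P.pt V w) ≤ dist (P.pt V x) (P.pt V y) + M := fun w hw => by
    have := hw V
    unfold CoarselyBetween at this
    linarith [dist_nonneg (x := P.pt V w) (y := P.pt V y)]
  have h2 := abs_sub_le_abs_truncate hD (by linarith : 0 ≤ M) dist_nonneg dist_nonneg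
    (hle u hu) (hle v hv)
  have h3 : |P.coord x y D V u - P.coord x y D V v| ≤ P.gap x y D R u v :=
    Finset.single_le_sum (f := fun T => |P.coord x y D T u - P.coord x y D T v|)
      (fun _ _ => abs_nonneg _) hV
  simp only [coord] at h3
  linarith

/-- The distance is coarsely bounded by the sum of the relevant projection distances. -/
theorem exists_dist_le_gap (P : PointedHierarchy X 𝔖 C) {D M : ℝ} (hD : 3 * P.B ≤ D)
    (hM : P.B ≤ M)
    (hmed : ∀ x y z : X, ∃ m : X, ∀ W, CoarselyBetween M (P.pt W x) (P.pt W m) (P.pt W y) ∧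
      CoarselyBetween M (P.pt W x) (P.pt W m) (P.pt W z) ∧
      CoarselyBetween M (P.pt W y) (P.pt W m) (P.pt W z)) (s : ℝ) :
    ∃ θ : ℝ, 0 ≤ θ ∧ ∀ (x y : X) (R : Finset 𝔖),
      (∀ T ∈ R, 2 * D + 12 * M < dist (P.pt T x) (P.pt T y)) →
      (∀ T, s ≤ dist (P.pt T x) (P.pt T y) → T ∈ R) →
        dist x y ≤ θ + θ * P.gap x y D R x y := by
  have hB := P.one_le_B
  set c : ℝ := 3 * ((P.n + 1) * (P.n + 1)) * (24 * M) with hc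
  have hn : (1 : ℝ) ≤ (P.n + 1) * (P.n + 1) := by
    have : (0 : ℝ) ≤ P.n := Nat.cast_nonneg _
    nlinarith
  have hc1 : 1 ≤ c := by nlinarith
  -- The first threshold makes the coordinate found by uniqueness belong to `R`; the second makes
  -- both halves of the subdivision have `gap` at least `2 * c`.
  obtain ⟨θ₀, hθ₀⟩ := P.uniqueness (max (s + 4 * M) (2 * (2 * c + 11 * M + 2 * D)))
  set θ : ℝ := max θ₀ 0 with hθ
  have hθ0 : 0 ≤ θ := le_max_right _ _
  refine ⟨θ, hθ0, fun x y R hR hR' => ?_⟩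
  -- The shift by `2 * c` makes the bound superadditive: splitting costs `c` in `gap` but subtracts
  -- `2 * c` once more, and the surplus `c ≥ 1` pays for the second additive `θ`. Each half has
  -- `gap` smaller by at least `c`, so the induction on `k` descends.
  have key : ∀ (k : ℕ) (u v : X), P.InHull M x y u → P.InHull M x y v →
      P.gap x y D R u v ≤ k →
        dist u v ≤ θ + θ * max 0 (P.gap x y D R u v - 2 * c) := by
    intro k
    induction k using Nat.strong_induction_on with
    | _ k ih =>
      intro u v hu hv hk
      by_cases hfar : θ₀ ≤ dist u v
      · obtain ⟨V, hV⟩ := hθ₀ u v hfar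
        have hV1 := (le_max_left _ _).trans hV
        have hV2 := (le_max_right _ _).trans hV
        have hVR : V ∈ R := by
          refine hR' V ?_
          have h1 := P.dist_le_abs_sub V M _ _ _ _ (hu V) (hv V)
          have hu' := hu V
          have hv' := hv V
          unfold CoarselyBetween at hu' hv'
          have := dist_nonneg (x := P.pt V u) (y := P.pt V y)
          have := dist_nonneg (x := P.pt V v) (y := P.pt V y)
          have := dist_nonneg (x := P.pt V x) (y := P.pt V u)
          have := dist_nonneg (x := P.pt V x) (y := P.pt V v)
          have h2 : |dist (P.pt V x) (P.pt V u) - dist (P.pt V x) (P.pt V v)| ≤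
              dist (P.pt V x) (P.pt V y) + M := abs_le.2 ⟨by linarith, by linarith⟩
          linarith
        obtain ⟨z, hz, hbet, h1, h2⟩ := hu.exists_between hM hmed hv V
        have h3 := hu.gap_add_gap_le hD hM hR hv hbet
        have h4 := hu.dist_le_gap (D := D) (by linarith) hM hz hVR
        have h5 := hz.dist_le_gap (D := D) (by linarith) hM hv hVR
        have h6 : 2 * c ≤ P.gap x y D R u z := by linarith
        have h7 : 2 * c ≤ P.gap x y D R z v := by linarith
        have hk1 : 1 ≤ k := by
          by_contra hk0
          have : k = 0 := by omega
          rw [this, Nat.cast_zero] at hk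
          linarith
        have hcast : ((k - 1 : ℕ) : ℝ) = k - 1 := by
          rw [Nat.cast_sub hk1, Nat.cast_one]
        have h8 := ih (k - 1) (by omega) u z hu hz (by rw [hcast]; linarith)
        have h9 := ih (k - 1) (by omega) z v hz hv (by rw [hcast]; linarith)
        rw [max_eq_right (by linarith)] at h8 h9
        rw [max_eq_right (by linarith)]
        have h10 := dist_triangle u z v
        have h11 : θ * (P.gap x y D R u z - 2 * c) + θ * (P.gap x y D R z v - 2 * c) + θ ≤
            θ * (P.gap x y D R u v - 2 * c) := by
          have : P.gap x y D R u z - 2 * c + (P.gap x y D R z v - 2 * c) + 1 ≤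
            P.gap x y D R u v - 2 * c := by linarith
          have := mul_le_mul_of_nonneg_left this hθ0
          linarith
        linarith
      · have h1 : 0 ≤ θ * max 0 (P.gap x y D R u v - 2 * c) :=
          mul_nonneg hθ0 (le_max_left _ _)
        have h2 : θ₀ ≤ θ := le_max_left _ _
        linarith
  have hgap : 0 ≤ P.gap x y D R x y := Finset.sum_nonneg fun _ _ => abs_nonneg _
  refine (key ⌈P.gap x y D R x y⌉₊ x y (fun T => ?_) (fun T => ?_) (Nat.le_ceil _)).trans ?_
  · unfold CoarselyBetween
    rw [dist_self]
    linarith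
  · unfold CoarselyBetween
    rw [dist_self]
    linarith
  · have := mul_le_mul_of_nonneg_left
      (max_le hgap (by linarith) : max 0 (P.gap x y D R x y - 2 * c) ≤ P.gap x y D R x y) hθ0
    linarith

/-! ### Assembly of the two bounds. -/

/-- The distance formula for pointed hierarchies. -/
theorem distance_formula (P : PointedHierarchy X 𝔖 C) : ∃ s₀ : ℝ, P.B ≤ s₀ ∧ ∀ s : ℝ,
    ∃ θ : ℝ, 0 ≤ θ ∧ ∀ (x y : X) (R : Finset 𝔖),
      (∀ T ∈ R, s₀ ≤ dist (P.pt T x) (P.pt T y)) →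
      (∀ T, s ≤ dist (P.pt T x) (P.pt T y) → T ∈ R) →
        dist x y ≤ θ + θ * ∑ T ∈ R, (dist (P.pt T x) (P.pt T y) - P.B) ∧
        ∑ T ∈ R, dist (P.pt T x) (P.pt T y) ≤ θ + θ * dist x y := by
  have hB := P.one_le_B
  have hBB : 0 ≤ P.B * P.B := mul_self_nonneg _
  obtain ⟨M, hM, hmed⟩ := P.exists_median
  refine ⟨12 * P.B + 12 * M + (P.B * P.B + P.B) + 1, by linarith, fun s => ?_⟩
  obtain ⟨θ, hθ, h⟩ := P.exists_dist_le_gap (D := 3 * P.B) le_rfl hM hmed s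
  set L : ℝ := 2 * (2 * ((P.n + 1) * (P.n + 1)) * (P.B * P.B + P.B)) * P.B with hL
  have hL0 : 0 ≤ L := by positivity
  refine ⟨θ + L, by linarith, fun x y R hR hR' => ⟨?_, ?_⟩⟩
  · have h1 := h x y R (fun T hT => by linarith [hR T hT]) hR'
    rw [gap_endpoints (by linarith) fun T hT => by linarith [hR T hT]] at h1
    -- Truncation discards `6 * B` per term, more than the `B` by which point distances may exceed
    -- set distances.
    have h2 : ∑ T ∈ R, (dist (P.pt T x) (P.pt T y) - 2 * (3 * P.B)) ≤
        ∑ T ∈ R, (dist (P.pt T x) (P.pt T y) - P.B) :=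
      Finset.sum_le_sum fun T _ => by linarith
    have h3 : 0 ≤ ∑ T ∈ R, (dist (P.pt T x) (P.pt T y) - P.B) :=
      Finset.sum_nonneg fun T hT => by linarith [hR T hT]
    have h4 := mul_le_mul_of_nonneg_left h2 hθ
    have h5 := mul_nonneg hL0 h3
    linarith
  · have h1 := sum_le_dist (P := P) (x := x) (y := y) (R := R) (D := 3 * P.B) le_rfl
      (fun T hT => by linarith [hR T hT])
    have h2 : 2 * (2 * ((P.n + 1) * (P.n + 1)) * (P.B * P.B + P.B)) * (P.B * dist x y + P.B) =
        L + L * dist x y := by rw [hL]; ring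
    have h3 : 0 ≤ θ * dist x y := mul_nonneg hθ dist_nonneg
    linarith

end PointedHierarchy

theorem mainTheorem1 {X : Type*} [MetricSpace X] {𝔖 : Type*} [PartialOrder 𝔖]
    {C : 𝔖 → Type*} [∀ W, MetricSpace (C W)] (H : HierarchicallyHyperbolicSpace X 𝔖 C) :
    ∃ s₀ : ℝ, ∀ s : ℝ, s₀ ≤ s → ∃ K D : ℝ, 1 ≤ K ∧ 0 ≤ D ∧
      ∀ x y : X, {W : 𝔖 | s ≤ H.projDist W x y}.Finite ∧
        CoarselyEqual K D (dist x y) (∑ᶠ W : 𝔖, ignoreBelow (H.projDist W x y) s) := by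
  -- A base point supplies default values where `ρ` may be empty.
  rcases isEmpty_or_nonempty X with hX | ⟨⟨x₀⟩⟩
  · exact ⟨0, fun _ _ => ⟨1, 0, le_rfl, le_rfl, fun x => isEmptyElim x⟩⟩
  obtain ⟨P, hP⟩ := H.exists_pointedHierarchy x₀
  obtain ⟨s₀, hs₀, h⟩ := P.distance_formula
  have hB := P.one_le_B
  refine ⟨s₀, fun s hs => ?_⟩
  -- Set distances select the terms and may be smaller by `B`, so only point distances from `s + B`
  -- on are certain to be selected.
  obtain ⟨θ, hθ, hd⟩ := h (s + P.B)
  refine ⟨1 + θ, 1 + θ, by linarith, by linarith, fun x y => ?_⟩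
  have hfin : {W : 𝔖 | s ≤ H.projDist W x y}.Finite :=
    (P.finite_relevant x y).subset fun W hW =>
      hs₀.trans (hs.trans (le_trans hW (hP W x y).1))
  refine ⟨hfin, ?_⟩
  have hmem : ∀ W, W ∈ hfin.toFinset ↔ s ≤ H.projDist W x y := fun W => by simp
  have hsum : ∑ᶠ W : 𝔖, ignoreBelow (H.projDist W x y) s =
      ∑ W ∈ hfin.toFinset, H.projDist W x y := by
    rw [finsum_eq_sum_of_support_subset (s := hfin.toFinset)]
    · exact Finset.sum_congr rfl fun W hW => if_pos ((hmem W).1 hW)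
    · intro W hW
      by_contra hcon
      exact hW (if_neg fun hle => hcon (Finset.mem_coe.2 ((hmem W).2 hle)))
  obtain ⟨h1, h2⟩ := hd x y hfin.toFinset
    (fun W hW => hs.trans (((hmem W).1 hW).trans (hP W x y).1))
    (fun W hW => (hmem W).2 (by linarith [(hP W x y).2]))
  have h3 : ∑ W ∈ hfin.toFinset, (dist (P.pt W x) (P.pt W y) - P.B) ≤
      ∑ W ∈ hfin.toFinset, H.projDist W x y :=
    Finset.sum_le_sum fun W _ => by linarith [(hP W x y).2]
  have h4 : ∑ W ∈ hfin.toFinset, H.projDist W x y ≤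
      ∑ W ∈ hfin.toFinset, dist (P.pt W x) (P.pt W y) :=
    Finset.sum_le_sum fun W _ => (hP W x y).1
  have h5 : 0 ≤ ∑ W ∈ hfin.toFinset, H.projDist W x y :=
    Finset.sum_nonneg fun W hW => by linarith [(hmem W).1 hW]
  rw [hsum]
  set A : ℝ := ∑ W ∈ hfin.toFinset, H.projDist W x y
  have h6 := mul_le_mul_of_nonneg_left h3 hθ
  constructor
  · rw [sub_le_iff_le_add, inv_mul_le_iff₀ (by linarith)]
    nlinarith
  · linarith [dist_nonneg (x := x) (y := y)]
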